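/- **Definitions.** A *distributive Markov category* is a symmetric monoidal category whose unit $1$ is terminal, in which every object carries a commutative comonoid structure $X\to X\otimes X$, $X\to 1$ compatible with $\otimes$ and $1$, together with chosen finite coproducts over which $\otimes$ distributes and whose injections are deterministic (a morphism is *deterministic* if it commutes with the comultiplications). A *(strict) distributive Markov functor* is a functor strictly preserving the chosen monoidal, symmetry, comonoid and coproduct structures. For such a category $\mathbf C$, $\mathbf C_{\mathbb N}$ is the distributive Markov category whose objects are the natural numbers and whose morphisms $m\to n$ are the morphisms of $\mathbf C$ between the numeral objects $1+\dots+1$ ($m$ summands) and $1+\dots+1$ ($n$ summands). $\mathbf{FinStoch}$ is the distributive Markov category of natural numbers and stochastic matrices, with $\otimes$ the Kronecker product and coproducts given by sums of numbers. A *Bernoulli base* for $\mathbf C$ is a faithful distributive Markov functor $\Psi:\mathbf C_{\mathbb N}\to\mathbf{FinStoch}$. The *graph interface* has a type constant $\mathsf{vertex}$ and term constants $\mathsf{new}:\mathsf{unit}\to\mathsf{vertex}$ and $\mathsf{edge}:\mathsf{vertex}*\mathsf{vertex}\to\mathsf{bool}$, where $\mathsf{bool}=\mathsf{unit}+\mathsf{unit}$.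 Given an object $[\![\mathsf{vertex}]\!]$ and morphisms $[\![\mathsf{new}]\!]:1\to[\![\mathsf{vertex}]\!]$ and $[\![\mathsf{edge}]\!]:[\![\mathsf{vertex}]\!]\otimes[\![\mathsf{vertex}]\!]\to 1+1$ of $\mathbf C$, the programs over this interface in the first-order language with $\mathsf{let}$, products, sums and case distinction are interpreted in $\mathbf C$ in the standard way, terms with equal interpretations being written $t\equiv u$. In particular, for $n\in\mathbb N$, the closed program $$t_n \;=\; \mathsf{let}\ x_1=\mathsf{new}()\ \mathsf{in}\ \cdots\ \mathsf{let}\ x_n=\mathsf{new}()\ \mathsf{in}\ \big(\mathsf{edge}(x_i,x_j)\big)_{1\le i,j\le n}\;:\;\mathsf{bool}^{(n^2)}$$ is interpreted by a morphism $[\![t_n]\!]:1\to 2^{(n^2)}$ of $\mathbf C_{\mathbb N}$, so that a Bernoulli base $\Psi$ gives a probability distribution $\Psi[\![t_n]\!]$ on the set of $n\times n$ matrices of booleans. A *graphon* is a symmetric measurable function $W:[0,1]^2\to[0,1]$. Its random graph model is the sequence of distributions $p_{W,n}$ on $n\times n$ matrices of booleans that are concentrated on the adjacency matrices of simple undirected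 graphs $g=([n],E)$ and given there by $$p_{W,n}(g)=\int_{[0,1]^n}\ \prod_{i<j,\ \{i,j\}\in E}W(x_i,x_j)\prod_{i<j,\ \{i,j\}\notin E}\big(1-W(x_i,x_j)\big)\ \mathrm d(x_1\ldots x_n).$$ **Statement.** For every graphon $W$ there exist a (small) distributive Markov category $\mathbf C$ with a Bernoulli base $\Psi$, and an interpretation in $\mathbf C$ of the graph interface for which $\mathsf{edge}$ is deterministic and $$x:\mathsf{vertex}\vdash\mathsf{edge}(x,x)\equiv\mathsf{false},\qquad x,y:\mathsf{vertex}\vdash\mathsf{edge}(x,y)\equiv\mathsf{edge}(y,x),$$ such that $\Psi[\![t_n]\!]=p_{W,n}$ for all $n\in\mathbb N$. -/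

import Mathlib

open CategoryTheory MonoidalCategory ComonObj

namespace GraphonMarkov
universe v u v' u'

section Markov

variable {C : Type u} [Category.{v} C] [MonoidalCategory C] [MarkovCategory C]

/-- The comultiplication `X ⟶ X ⊗ X` of a Markov category. -/
def copy (X : C) : X ⟶ X ⊗ X := (CopyDiscardCategory.comonObj X).comul

/-- The unique morphism `X ⟶ 1` of a Markov category. -/
def discard (X : C) : X ⟶ 𝟙_ C := (CopyDiscardCategory.comonObj X).counit

/-- A morphism is deterministic if it commutes with the comultiplications. -/
def IsDeterministic {X Y : C} (f : X ⟶ Y) : Prop := f ≫ copy Y = copy X ≫ (f ⊗ₘ f)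

theorem copy_tensor (X Y : C) : copy (X ⊗ Y) = (copy X ⊗ₘ copy Y) ≫ tensorμ X X Y Y :=
  CopyDiscardCategory.copy_tensor X Y

theorem copy_unit : copy (𝟙_ C) = (λ_ (𝟙_ C)).inv := CopyDiscardCategory.copy_unit

theorem IsDeterministic.id (X : C) : IsDeterministic (𝟙 X) := by simp [IsDeterministic]

theorem IsDeterministic.comp {X Y Z : C} {f : X ⟶ Y} {g : Y ⟶ Z} (hf : IsDeterministic f)
    (hg : IsDeterministic g) : IsDeterministic (f ≫ g) := by
  unfold IsDeterministic at *
  rw [Category.assoc, hg, reassoc_of% hf, tensorHom_comp_tensorHom]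

theorem IsDeterministic.tensor {X X' Y Y' : C} {f : X ⟶ X'} {g : Y ⟶ Y'} (hf : IsDeterministic f)
    (hg : IsDeterministic g) : IsDeterministic (f ⊗ₘ g) := by
  unfold IsDeterministic at *
  rw [copy_tensor, copy_tensor, Category.assoc, ← tensorμ_natural, tensorHom_comp_tensorHom_assoc,
    tensorHom_comp_tensorHom_assoc, hf, hg]

theorem isDeterministic_leftUnitor_inv : IsDeterministic (λ_ (𝟙_ C)).inv := by
  unfold IsDeterministic
  rw [copy_tensor, copy_unit, tensorμ, braiding_tensorUnit_left]
  monoidal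

end Markov

/-- A distributive Markov category: a Markov category with chosen finite coproducts (an initial
object `zero` and binary coproducts `X ⊞ Y`), over which the tensor product distributes, and whose
coproduct injections are deterministic. -/
class DistributiveMarkovCategory (C : Type u) [Category.{v} C] [MonoidalCategory C]
    extends MarkovCategory C where
  /-- the chosen initial object -/
  zero : C
  /-- the unique morphism out of the initial object -/
  fromZero (X : C) : zero ⟶ X
  fromZero_uniq {X : C} (f : zero ⟶ X) : f = fromZero X
  /-- the chosen binary coproduct -/
  coprod : C → C → C
  inl (X Y : C) : X ⟶ coprod X Y
  inr (X Y : C) : Y ⟶ coprod X Y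
  /-- copairing -/
  desc {X Y Z : C} (f : X ⟶ Z) (g : Y ⟶ Z) : coprod X Y ⟶ Z
  inl_desc {X Y Z : C} (f : X ⟶ Z) (g : Y ⟶ Z) : inl X Y ≫ desc f g = f
  inr_desc {X Y Z : C} (f : X ⟶ Z) (g : Y ⟶ Z) : inr X Y ≫ desc f g = g
  desc_uniq {X Y Z : C} (h : coprod X Y ⟶ Z) : h = desc (inl X Y ≫ h) (inr X Y ≫ h)
  /-- the canonical map `X ⊗ Z + Y ⊗ Z ⟶ (X + Y) ⊗ Z` is an isomorphism -/
  isIso_distrib (X Y Z : C) :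
    IsIso (desc (inl X Y ▷ Z) (inr X Y ▷ Z) : coprod (X ⊗ Z) (Y ⊗ Z) ⟶ coprod X Y ⊗ Z)
  /-- the canonical map `0 ⟶ 0 ⊗ Z` is an isomorphism -/
  isIso_fromZero (Z : C) : IsIso (fromZero (zero ⊗ Z))
  isDeterministic_inl (X Y : C) : IsDeterministic (inl X Y)
  isDeterministic_inr (X Y : C) : IsDeterministic (inr X Y)

open DistributiveMarkovCategory

infixl:65 " ⊞ " => DistributiveMarkovCategory.coprod

/-- Pairing of indices: the lexicographic bijection between pairs and `Fin (m * n)`. -/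
def pr {m n : ℕ} : Fin m × Fin n ≃ Fin (m * n) := finProdFinEquiv

theorem forall_pr {m n : ℕ} {p : Fin (m * n) → Prop} :
    (∀ i, p i) ↔ ∀ (i : Fin m) (j : Fin n), p (pr (i, j)) := by
  rw [pr.surjective.forall, Prod.forall]

/-- The category of stochastic matrices; its objects are natural numbers. -/
structure FinStoch where
  dim : ℕ

namespace FinStoch

/-- A morphism `m ⟶ n` is an `m × n` matrix of non-negative reals, each row of which sums to 1. -/
@[ext] structure Hom (m n : FinStoch) where
  mat : Matrix (Fin m.dim) (Fin n.dim) ℝ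
  nonneg : ∀ i j, 0 ≤ mat i j
  row_sum : ∀ i, ∑ j, mat i j = 1

noncomputable instance : Category FinStoch where
  Hom := Hom
  id m := ⟨1, fun i j => by simp only [Matrix.one_apply]; split <;> simp,
    fun i => by simp [Matrix.one_apply]⟩
  comp f g := ⟨f.mat * g.mat,
    fun i j => by
      rw [Matrix.mul_apply]
      exact Finset.sum_nonneg fun k _ => mul_nonneg (f.nonneg i k) (g.nonneg k j),
    fun i => by
      simp only [Matrix.mul_apply]
      rw [Finset.sum_comm]
      simp [← Finset.mul_sum, g.row_sum, f.row_sum]⟩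
  id_comp f := Hom.ext (Matrix.one_mul _)
  comp_id f := Hom.ext (Matrix.mul_one _)
  assoc f g h := Hom.ext (Matrix.mul_assoc _ _ _)

@[ext] theorem hom_ext {m n : FinStoch} {f g : m ⟶ n} (h : ∀ i j, f.mat i j = g.mat i j) : f = g :=
  Hom.ext (funext₂ h)

theorem comp_apply {l m n : FinStoch} (f : l ⟶ m) (g : m ⟶ n) (i j) :
    (f ≫ g).mat i j = ∑ k, f.mat i k * g.mat k j := rfl

theorem id_mat (m : FinStoch) : (𝟙 m : m ⟶ m).mat = 1 := rfl

/-- The `0/1`-valued matrix of a function. -/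
def ofFun {m n : FinStoch} (f : Fin m.dim → Fin n.dim) : m ⟶ n :=
  Hom.mk (fun i j => if f i = j then 1 else 0) (fun i j => by split <;> simp) (fun i => by simp)

theorem ofFun_apply {m n : FinStoch} (f : Fin m.dim → Fin n.dim) (i j) :
    (ofFun f).mat i j = if f i = j then 1 else 0 := rfl

theorem ofFun_comp_apply {l m n : FinStoch} (f : Fin l.dim → Fin m.dim) (g : m ⟶ n) (i j) :
    (ofFun f ≫ g).mat i j = g.mat (f i) j := by
  simp [comp_apply, ofFun_apply]

theorem ofFun_comp_ofFun {l m n : FinStoch} (f : Fin l.dim → Fin m.dim)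
    (g : Fin m.dim → Fin n.dim) : (ofFun f ≫ ofFun g : l ⟶ n) = ofFun (g ∘ f) := by
  ext i j
  rw [ofFun_comp_apply]; rfl

theorem ofFun_id (m : FinStoch) : (ofFun id : m ⟶ m) = 𝟙 m := by
  ext i j
  simp [ofFun_apply, id_mat, Matrix.one_apply]

/-- The isomorphism given by a bijection. -/
def ofEquiv {m n : FinStoch} (e : Fin m.dim ≃ Fin n.dim) : m ≅ n where
  hom := ofFun e
  inv := ofFun e.symm
  hom_inv_id := by rw [ofFun_comp_ofFun, ← ofFun_id]; congr 1; ext; simp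
  inv_hom_id := by rw [ofFun_comp_ofFun, ← ofFun_id]; congr 1; ext; simp

theorem comp_ofEquiv_apply {l m n : FinStoch} (f : l ⟶ m) (e : Fin m.dim ≃ Fin n.dim) (i j) :
    (f ≫ (ofEquiv e).hom).mat i j = f.mat i (e.symm j) := by
  simp [comp_apply, ofEquiv, ofFun_apply, ← Equiv.eq_symm_apply]

/-- The Kronecker product, with pairs of indices ordered lexicographically. -/
noncomputable def tensor {m m' n n' : FinStoch} (f : m ⟶ m') (g : n ⟶ n') :
    (⟨m.dim * n.dim⟩ : FinStoch) ⟶ ⟨m'.dim * n'.dim⟩ :=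
  Hom.mk ((Matrix.kroneckerMap (· * ·) f.mat g.mat).reindex pr pr)
    (fun i j => mul_nonneg (f.nonneg _ _) (g.nonneg _ _))
    (fun i => by
      rw [← pr.sum_comp]
      simp [Matrix.kroneckerMap, Fintype.sum_prod_type, ← Finset.mul_sum, f.row_sum, g.row_sum])

theorem tensor_apply {m m' n n' : FinStoch} (f : m ⟶ m') (g : n ⟶ n') (i j k l) :
    (tensor f g).mat (pr (i, k)) (pr (j, l)) = f.mat i j * g.mat k l := by
  simp [tensor]

theorem sum_pr {m n : ℕ} (f : Fin (m * n) → ℝ) : ∑ i, f i = ∑ i, ∑ j, f (pr (i, j)) := by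
  rw [← pr.sum_comp, Fintype.sum_prod_type]

/-- Reassociation of indices. -/
def assocEquiv (l m n : ℕ) : Fin (l * m * n) ≃ Fin (l * (m * n)) :=
  pr.symm.trans <| (Equiv.prodCongr pr.symm (Equiv.refl _)).trans <|
    (Equiv.prodAssoc _ _ _).trans <| (Equiv.prodCongr (Equiv.refl _) pr).trans pr

/-- Removal of the trivial index on the left. -/
def leftUnitEquiv (n : ℕ) : Fin (1 * n) ≃ Fin n := pr.symm.trans (Equiv.uniqueProd _ (Fin 1))

/-- Removal of the trivial index on the right. -/
def rightUnitEquiv (n : ℕ) : Fin (n * 1) ≃ Fin n := pr.symm.trans (Equiv.prodUnique _ (Fin 1))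

/-- Swapping of indices. -/
def swapEquiv (m n : ℕ) : Fin (m * n) ≃ Fin (n * m) :=
  pr.symm.trans <| (Equiv.prodComm _ _).trans pr

@[simp] theorem assocEquiv_pr {l m n : ℕ} (i : Fin l) (j : Fin m) (k : Fin n) :
    assocEquiv l m n (pr (pr (i, j), k)) = pr (i, pr (j, k)) := by simp [assocEquiv]

@[simp] theorem assocEquiv_symm_pr {l m n : ℕ} (i : Fin l) (j : Fin m) (k : Fin n) :
    (assocEquiv l m n).symm (pr (i, pr (j, k))) = pr (pr (i, j), k) := by simp [assocEquiv]

@[simp] theorem leftUnitEquiv_pr {n : ℕ} (i : Fin 1) (j : Fin n) :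
    leftUnitEquiv n (pr (i, j)) = j := by simp [leftUnitEquiv]

@[simp] theorem leftUnitEquiv_symm {n : ℕ} (j : Fin n) :
    (leftUnitEquiv n).symm j = pr (0, j) := by simp [Equiv.symm_apply_eq]

@[simp] theorem rightUnitEquiv_pr {n : ℕ} (i : Fin 1) (j : Fin n) :
    rightUnitEquiv n (pr (j, i)) = j := by simp [rightUnitEquiv]

@[simp] theorem rightUnitEquiv_symm {n : ℕ} (j : Fin n) :
    (rightUnitEquiv n).symm j = pr (j, 0) := by simp [Equiv.symm_apply_eq]

@[simp] theorem swapEquiv_pr {m n : ℕ} (i : Fin m) (j : Fin n) :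
    swapEquiv m n (pr (i, j)) = pr (j, i) := by simp [swapEquiv]

@[simp] theorem swapEquiv_symm_pr {m n : ℕ} (i : Fin m) (j : Fin n) :
    (swapEquiv m n).symm (pr (j, i)) = pr (i, j) := by simp [swapEquiv]

noncomputable instance : MonoidalCategoryStruct FinStoch where
  tensorObj m n := ⟨m.dim * n.dim⟩
  tensorUnit := ⟨1⟩
  tensorHom f g := tensor f g
  whiskerLeft m _ _ g := tensor (𝟙 m) g
  whiskerRight f n := tensor f (𝟙 n)
  associator l m n := ofEquiv (assocEquiv l.dim m.dim n.dim)
  leftUnitor n := ofEquiv (leftUnitEquiv n.dim)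
  rightUnitor n := ofEquiv (rightUnitEquiv n.dim)

theorem tensor_dim (m n : FinStoch) : (m ⊗ n).dim = m.dim * n.dim := rfl

theorem unit_dim : (𝟙_ FinStoch).dim = 1 := rfl

theorem tensorHom_apply {m m' n n' : FinStoch} (f : m ⟶ m') (g : n ⟶ n') (i j k l) :
    (f ⊗ₘ g).mat (pr (i, k)) (pr (j, l)) = f.mat i j * g.mat k l := tensor_apply f g i j k l

theorem tensorHom_ofFun {m m' n n' : FinStoch} (f : Fin m.dim → Fin m'.dim)
    (g : Fin n.dim → Fin n'.dim) :
    ((ofFun f : m ⟶ m') ⊗ₘ (ofFun g : n ⟶ n')) =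
      ofFun (m := m ⊗ n) (n := m' ⊗ n') (fun i => pr (f (pr.symm i).1, g (pr.symm i).2)) := by
  apply hom_ext
  refine forall_pr.2 fun i k => forall_pr.2 fun j l => ?_
  rw [tensorHom_apply]
  simp only [ofFun_apply, Equiv.symm_apply_apply, EmbeddingLike.apply_eq_iff_eq, Prod.mk.injEq, ite_and]
  split <;> split <;> simp

theorem ofEquiv_hom {m n : FinStoch} (e : Fin m.dim ≃ Fin n.dim) :
    (ofEquiv e).hom = (ofFun e : m ⟶ n) := rfl

theorem id_eq_ofFun (m : FinStoch) : 𝟙 m = ofFun id := (ofFun_id m).symm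

noncomputable instance : MonoidalCategory FinStoch :=
  MonoidalCategory.ofTensorHom
    (id_tensorHom_id := fun m n => by
      rw [id_eq_ofFun, id_eq_ofFun, id_eq_ofFun, tensorHom_ofFun]
      congr 1; ext1 i; simp)
    (id_tensorHom := fun _ _ _ _ => rfl)
    (tensorHom_id := fun _ _ => rfl)
    (tensorHom_comp_tensorHom := fun f₁ f₂ g₁ g₂ => by
      apply hom_ext
      refine forall_pr.2 fun i k => forall_pr.2 fun j l => ?_
      rw [tensorHom_apply, comp_apply, comp_apply, comp_apply]
      refine (sum_pr _).trans ?_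
      simp_rw [tensorHom_apply, Finset.sum_mul_sum]
      exact Finset.sum_congr rfl fun _ _ => Finset.sum_congr rfl fun _ _ => by ring)
    (associator_naturality := fun {X₁ X₂ X₃ Y₁ Y₂ Y₃} f₁ f₂ f₃ => by
      apply hom_ext
      refine forall_pr.2 fun i k => forall_pr.2 fun j l => ?_
      revert i l
      refine forall_pr.2 fun i i' => forall_pr.2 fun l l' => ?_
      refine (comp_ofEquiv_apply _ _ _ _).trans ?_
      refine Eq.trans ?_ (ofFun_comp_apply _ _ _ _).symm
      rw [assocEquiv_pr, assocEquiv_symm_pr]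
      erw [tensorHom_apply, tensorHom_apply, tensorHom_apply, tensorHom_apply]
      ring)
    (leftUnitor_naturality := fun f => by
      apply hom_ext
      refine forall_pr.2 fun i k j => ?_
      refine (comp_ofEquiv_apply _ _ _ _).trans ?_
      refine Eq.trans ?_ (ofFun_comp_apply _ _ _ _).symm
      rw [leftUnitEquiv_pr, leftUnitEquiv_symm]
      erw [tensorHom_apply]
      simp [id_mat, show i = 0 from Subsingleton.elim (α := Fin 1) i 0])
    (rightUnitor_naturality := fun f => by
      apply hom_ext
      refine forall_pr.2 fun i k j => ?_
      refine (comp_ofEquiv_apply _ _ _ _).trans ?_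
      refine Eq.trans ?_ (ofFun_comp_apply _ _ _ _).symm
      rw [rightUnitEquiv_pr, rightUnitEquiv_symm]
      erw [tensorHom_apply]
      simp [id_mat, show k = 0 from Subsingleton.elim (α := Fin 1) k 0])
    (pentagon := fun k l m n => by
      simp only [id_eq_ofFun]
      refine (congrArg₂ _ (tensorHom_ofFun _ _)
        (congrArg₂ _ rfl (tensorHom_ofFun _ _))).trans ?_
      refine (congrArg₂ _ rfl (ofFun_comp_ofFun _ _)).trans ?_
      refine (ofFun_comp_ofFun _ _).trans ?_
      refine Eq.trans ?_ (ofFun_comp_ofFun _ _).symm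
      congr 1
      funext i
      revert i
      refine forall_pr.2 fun i d => ?_
      revert i
      refine forall_pr.2 fun i c => ?_
      revert i
      refine forall_pr.2 fun a b => ?_
      dsimp only [tensor_dim, unit_dim]
      simp)
    (triangle := fun m n => by
      simp only [id_eq_ofFun]
      refine (congrArg₂ _ rfl (tensorHom_ofFun _ _)).trans ?_
      refine (ofFun_comp_ofFun _ _).trans ?_
      refine Eq.trans ?_ (tensorHom_ofFun _ _).symm
      congr 1
      funext i
      revert i
      refine forall_pr.2 fun i c => ?_
      revert i
      refine forall_pr.2 fun a b => ?_
      dsimp only [tensor_dim, unit_dim]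
      simp)

theorem whiskerLeft_eq (m : FinStoch) {n n' : FinStoch} (f : n ⟶ n') : m ◁ f = 𝟙 m ⊗ₘ f := rfl

theorem whiskerRight_eq {m m' : FinStoch} (f : m ⟶ m') (n : FinStoch) : f ▷ n = f ⊗ₘ 𝟙 n := rfl

theorem whiskerLeft_apply (m : FinStoch) {n n' : FinStoch} (f : n ⟶ n') (i k j l) :
    (m ◁ f).mat (pr (i, k)) (pr (j, l)) = (1 : Matrix _ _ ℝ) i j * f.mat k l := tensor_apply ..

theorem whiskerRight_apply {m m' : FinStoch} (f : m ⟶ m') (n : FinStoch) (i k j l) :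
    (f ▷ n).mat (pr (i, k)) (pr (j, l)) = f.mat i j * (1 : Matrix _ _ ℝ) k l := tensor_apply ..

theorem whiskerLeft_ofFun (m : FinStoch) {n n' : FinStoch} (f : Fin n.dim → Fin n'.dim) :
    m ◁ (ofFun f : n ⟶ n') =
      ofFun (m := m ⊗ n) (n := m ⊗ n') (fun i => pr ((pr.symm i).1, f (pr.symm i).2)) := by
  rw [whiskerLeft_eq, id_eq_ofFun]
  exact tensorHom_ofFun _ _

theorem whiskerRight_ofFun {m m' : FinStoch} (f : Fin m.dim → Fin m'.dim) (n : FinStoch) :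
    (ofFun f : m ⟶ m') ▷ n =
      ofFun (m := m ⊗ n) (n := m' ⊗ n) (fun i => pr (f (pr.symm i).1, (pr.symm i).2)) := by
  rw [whiskerRight_eq, id_eq_ofFun]
  exact tensorHom_ofFun _ _

theorem associator_eq (l m n : FinStoch) :
    (α_ l m n).hom = ofFun (assocEquiv l.dim m.dim n.dim) := rfl

theorem associator_inv_eq (l m n : FinStoch) :
    (α_ l m n).inv = ofFun (assocEquiv l.dim m.dim n.dim).symm := rfl

noncomputable instance : BraidedCategory FinStoch where
  braiding m n := ofEquiv (swapEquiv m.dim n.dim)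
  braiding_naturality_left f n := by
    apply hom_ext
    refine forall_pr.2 fun i k => forall_pr.2 fun j l => ?_
    refine (comp_ofEquiv_apply _ _ _ _).trans ?_
    refine Eq.trans ?_ (ofFun_comp_apply _ _ _ _).symm
    rw [swapEquiv_pr, swapEquiv_symm_pr]
    refine (whiskerRight_apply _ _ _ _ _ _).trans (Eq.trans ?_ (whiskerLeft_apply _ _ _ _ _ _).symm)
    ring
  braiding_naturality_right m _ _ f := by
    apply hom_ext
    refine forall_pr.2 fun i k => forall_pr.2 fun j l => ?_
    refine (comp_ofEquiv_apply _ _ _ _).trans ?_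
    refine Eq.trans ?_ (ofFun_comp_apply _ _ _ _).symm
    rw [swapEquiv_pr, swapEquiv_symm_pr]
    refine (whiskerLeft_apply _ _ _ _ _ _).trans (Eq.trans ?_ (whiskerRight_apply _ _ _ _ _ _).symm)
    ring
  hexagon_forward l m n := by
    simp only [associator_eq, ofEquiv_hom, whiskerLeft_ofFun, whiskerRight_ofFun, ofFun_comp_ofFun]
    congr 1
    funext i
    revert i
    refine forall_pr.2 fun i c => ?_
    revert i
    refine forall_pr.2 fun a b => ?_
    dsimp only [tensor_dim, unit_dim]
    simp
  hexagon_reverse l m n := by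
    change (ofEquiv _).inv ≫ _ ≫ (ofEquiv _).inv = _ ≫ (ofEquiv _).inv ≫ _
    simp only [ofEquiv, whiskerLeft_ofFun, whiskerRight_ofFun, ofFun_comp_ofFun]
    congr 1
    funext i
    revert i
    refine forall_pr.2 fun a i => ?_
    revert i
    refine forall_pr.2 fun b c => ?_
    dsimp only [tensor_dim, unit_dim]
    simp

theorem braiding_eq (m n : FinStoch) : (β_ m n).hom = ofFun (swapEquiv m.dim n.dim) := rfl

theorem leftUnitor_eq (n : FinStoch) : (λ_ n).hom = ofFun (leftUnitEquiv n.dim) := rfl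

theorem leftUnitor_inv_eq (n : FinStoch) : (λ_ n).inv = ofFun (leftUnitEquiv n.dim).symm := rfl

theorem rightUnitor_inv_eq (n : FinStoch) : (ρ_ n).inv = ofFun (rightUnitEquiv n.dim).symm := rfl

noncomputable instance : SymmetricCategory FinStoch where
  symmetry m n := by
    simp only [braiding_eq, ofFun_comp_ofFun, id_eq_ofFun]
    congr 1
    funext i
    revert i
    refine forall_pr.2 fun a b => ?_
    dsimp only [tensor_dim, unit_dim]
    simp

theorem eq_to_unit {m : FinStoch} (f g : m ⟶ 𝟙_ FinStoch) : f = g := by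
  have key (f : m ⟶ 𝟙_ FinStoch) (i) (j : Fin 1) : f.mat i j = 1 := by
    rw [← f.row_sum i, Subsingleton.elim j 0]
    exact (Fin.sum_univ_one (f.mat i)).symm
  ext i j
  rw [key f, key g]

/-- Copying and discarding, as for the corresponding functions. -/
noncomputable instance comonObj (m : FinStoch) : ComonObj m where
  counit := (ofFun fun _ => (0 : Fin 1) : m ⟶ ⟨1⟩)
  comul := (ofFun fun i => pr (i, i) : m ⟶ ⟨m.dim * m.dim⟩)
  counit_comul := by
    simp only [leftUnitor_inv_eq, whiskerRight_ofFun]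
    refine (ofFun_comp_ofFun _ _).trans ?_
    congr 1
    funext i
    simp
  comul_counit := by
    simp only [rightUnitor_inv_eq, whiskerLeft_ofFun]
    refine (ofFun_comp_ofFun _ _).trans ?_
    congr 1
    funext i
    simp
  comul_assoc := by
    rw [whiskerRight_eq, whiskerLeft_eq, id_eq_ofFun]
    refine (congrArg₂ _ rfl (tensorHom_ofFun _ _)).trans ?_
    refine (ofFun_comp_ofFun _ _).trans ?_
    refine Eq.trans ?_ (congrArg₂ _ rfl (congrArg₂ _ (tensorHom_ofFun _ _) rfl)).symm
    refine Eq.trans ?_ (congrArg₂ _ rfl (ofFun_comp_ofFun _ _)).symm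
    refine Eq.trans ?_ (ofFun_comp_ofFun _ _).symm
    congr 1
    funext i
    dsimp only [tensor_dim, unit_dim, Function.comp]
    simp

theorem comul_eq (m : FinStoch) :
    Δ[m] = (ofFun fun i => pr (i, i) : m ⟶ ⟨m.dim * m.dim⟩) := rfl

noncomputable instance : MarkovCategory FinStoch where
  isCommComonObj m :=
    { comul_comm := by
        refine (ofFun_comp_ofFun _ _).trans ?_
        rw [comul_eq]
        congr 1
        funext i
        exact swapEquiv_pr i i }
  copy_tensor m n := by
    simp only [tensorμ, associator_eq, associator_inv_eq, braiding_eq, whiskerLeft_ofFun,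
      whiskerRight_ofFun, comul_eq]
    refine Eq.trans ?_ (congrArg₂ _ (tensorHom_ofFun _ _).symm rfl)
    refine Eq.trans ?_ (congrArg₂ _ rfl (congrArg₂ _ rfl (congrArg₂ _ rfl
      (congrArg₂ _ rfl (ofFun_comp_ofFun _ _)))).symm)
    refine Eq.trans ?_ (congrArg₂ _ rfl (congrArg₂ _ rfl (congrArg₂ _ rfl
      (ofFun_comp_ofFun _ _))).symm)
    refine Eq.trans ?_ (congrArg₂ _ rfl (congrArg₂ _ rfl (ofFun_comp_ofFun _ _)).symm)
    refine Eq.trans ?_ (congrArg₂ _ rfl (ofFun_comp_ofFun _ _)).symm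
    refine Eq.trans ?_ (ofFun_comp_ofFun _ _).symm
    congr 1
    funext i
    revert i
    refine forall_pr.2 fun a b => ?_
    dsimp only [tensor_dim, unit_dim, Function.comp]
    simp
  discard_tensor _ _ := eq_to_unit _ _
  copy_unit := by
    rw [comul_eq, leftUnitor_inv_eq]
    congr 1
    funext i
    simp [show i = 0 from Subsingleton.elim (α := Fin 1) i 0]
  discard_unit := eq_to_unit _ _
  discard_natural _ := eq_to_unit _ _

theorem isDeterministic_ofFun {m n : FinStoch} (f : Fin m.dim → Fin n.dim) :
    IsDeterministic (ofFun f : m ⟶ n) := by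
  unfold IsDeterministic
  rw [tensorHom_ofFun]
  refine (ofFun_comp_ofFun _ _).trans ?_
  refine Eq.trans ?_ (ofFun_comp_ofFun _ _).symm
  congr 1
  funext i
  dsimp only [tensor_dim, Function.comp]
  simp

/-- The block matrix with the rows of `f` followed by the rows of `g`. -/
noncomputable def copair {m n k : FinStoch} (f : m ⟶ k) (g : n ⟶ k) :
    (⟨m.dim + n.dim⟩ : FinStoch) ⟶ k :=
  Hom.mk (fun i j => Fin.addCases (fun a => f.mat a j) (fun b => g.mat b j) i)
    (fun i j => by
      refine Fin.addCases (fun a => ?_) (fun b => ?_) i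
      · simpa using f.nonneg a j
      · simpa using g.nonneg b j)
    (fun i => by
      refine Fin.addCases (fun a => ?_) (fun b => ?_) i
      · simpa using f.row_sum a
      · simpa using g.row_sum b)

theorem ofFun_castAdd_comp_copair {m n k : FinStoch} (f : m ⟶ k) (g : n ⟶ k) :
    ofFun (m := m) (n := ⟨m.dim + n.dim⟩) (Fin.castAdd n.dim) ≫ copair f g = f := by
  ext i j
  rw [ofFun_comp_apply]
  simp [copair]

theorem ofFun_natAdd_comp_copair {m n k : FinStoch} (f : m ⟶ k) (g : n ⟶ k) :
    ofFun (m := n) (n := ⟨m.dim + n.dim⟩) (Fin.natAdd m.dim) ≫ copair f g = g := by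
  ext i j
  rw [ofFun_comp_apply]
  simp [copair]

theorem copair_uniq {m n k : FinStoch} (h : (⟨m.dim + n.dim⟩ : FinStoch) ⟶ k) :
    h = copair (ofFun (m := m) (n := ⟨m.dim + n.dim⟩) (Fin.castAdd n.dim) ≫ h)
      (ofFun (m := n) (n := ⟨m.dim + n.dim⟩) (Fin.natAdd m.dim) ≫ h) := by
  ext i j
  refine Fin.addCases (fun a => ?_) (fun b => ?_) i
  · simp [copair, ofFun_comp_apply]
  · simp [copair, ofFun_comp_apply]

theorem copair_ofFun {m n k : FinStoch} (f : Fin m.dim → Fin k.dim) (g : Fin n.dim → Fin k.dim) :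
    copair (ofFun f : m ⟶ k) (ofFun g : n ⟶ k) = ofFun (Fin.addCases f g) := by
  ext i j
  refine Fin.addCases (fun a => ?_) (fun b => ?_) i
  · simp [copair, ofFun_apply]
  · simp [copair, ofFun_apply]

end FinStoch

/-- Distributivity for indices. -/
def distribEquiv (l m n : ℕ) : Fin (l * n + m * n) ≃ Fin ((l + m) * n) :=
  finSumFinEquiv.symm.trans <| (Equiv.sumCongr pr.symm pr.symm).trans <|
    (Equiv.sumProdDistrib _ _ _).symm.trans <|
    (Equiv.prodCongr finSumFinEquiv (Equiv.refl _)).trans pr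

@[simp] theorem distribEquiv_castAdd {l m n : ℕ} (i : Fin l) (k : Fin n) :
    distribEquiv l m n (Fin.castAdd _ (pr (i, k))) = pr (Fin.castAdd m i, k) := by
  simp [distribEquiv]

@[simp] theorem distribEquiv_natAdd {l m n : ℕ} (j : Fin m) (k : Fin n) :
    distribEquiv l m n (Fin.natAdd _ (pr (j, k))) = pr (Fin.natAdd l j, k) := by
  simp [distribEquiv]

namespace FinStoch

noncomputable instance : DistributiveMarkovCategory FinStoch where
  zero := ⟨0⟩
  fromZero n := ofFun (m := ⟨0⟩) (n := n) Fin.elim0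
  fromZero_uniq f := hom_ext fun i => Fin.elim0 i
  coprod m n := ⟨m.dim + n.dim⟩
  inl m n := ofFun (m := m) (n := ⟨m.dim + n.dim⟩) (Fin.castAdd n.dim)
  inr m n := ofFun (m := n) (n := ⟨m.dim + n.dim⟩) (Fin.natAdd m.dim)
  desc := copair
  inl_desc := ofFun_castAdd_comp_copair
  inr_desc := ofFun_natAdd_comp_copair
  desc_uniq := copair_uniq
  isIso_distrib l m n := by
    refine Eq.mpr (congrArg IsIso (?_ : _ = (ofEquiv (m := ⟨l.dim * n.dim + m.dim * n.dim⟩)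
      (n := ⟨(l.dim + m.dim) * n.dim⟩) (distribEquiv l.dim m.dim n.dim)).hom)) (Iso.isIso_hom _)
    rw [whiskerRight_ofFun, whiskerRight_ofFun]
    refine (copair_ofFun (m := ⟨l.dim * n.dim⟩) (n := ⟨m.dim * n.dim⟩)
      (k := ⟨(l.dim + m.dim) * n.dim⟩) _ _).trans ?_
    rw [ofEquiv_hom]
    congr 1
    funext i
    refine Fin.addCases (fun a => ?_) (fun b => ?_) i
    · revert a
      refine forall_pr.2 fun a c => ?_
      dsimp only [tensor_dim]
      simp
    · revert b
      refine forall_pr.2 fun a c => ?_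
      dsimp only [tensor_dim]
      simp
  isIso_fromZero n := by
    refine ⟨(ofEquiv (m := ⟨0 * n.dim⟩) (n := ⟨0⟩) (finCongr (Nat.zero_mul _))).hom, ?_, ?_⟩
    · exact hom_ext fun i => Fin.elim0 i
    · exact hom_ext fun i => Fin.elim0 (Fin.cast (Nat.zero_mul _) i)
  isDeterministic_inl _ _ := isDeterministic_ofFun _
  isDeterministic_inr _ _ := isDeterministic_ofFun _

end FinStoch
end GraphonMarkov

namespace GraphonMarkov
open DistributiveMarkovCategory
universe v u v' u'

section Numerals

variable {C : Type u} [Category.{v} C] [MonoidalCategory C] [DistributiveMarkovCategory C]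

theorem coprod_hom_ext {X Y Z : C} {f g : X ⊞ Y ⟶ Z} (hl : inl X Y ≫ f = inl X Y ≫ g)
    (hr : inr X Y ≫ f = inr X Y ≫ g) : f = g := by
  rw [desc_uniq f, desc_uniq g, hl, hr]

theorem zero_hom_ext {X : C} (f g : (zero : C) ⟶ X) : f = g :=
  (fromZero_uniq f).trans (fromZero_uniq g).symm

instance (X Y Z : C) :
    IsIso (desc (inl X Y ▷ Z) (inr X Y ▷ Z) : (X ⊗ Z) ⊞ (Y ⊗ Z) ⟶ (X ⊞ Y) ⊗ Z) :=
  isIso_distrib X Y Z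

instance (Z : C) : IsIso (fromZero ((zero : C) ⊗ Z)) := isIso_fromZero Z

/-- The inverse of the canonical map `X ⊗ Z + Y ⊗ Z ⟶ (X + Y) ⊗ Z`. -/
noncomputable def distrib (X Y Z : C) : (X ⊞ Y) ⊗ Z ⟶ (X ⊗ Z) ⊞ (Y ⊗ Z) :=
  inv (desc (inl X Y ▷ Z) (inr X Y ▷ Z))

theorem inl_distrib (X Y Z : C) : inl X Y ▷ Z ≫ distrib X Y Z = inl _ _ := by
  rw [distrib, IsIso.comp_inv_eq, inl_desc]

theorem inr_distrib (X Y Z : C) : inr X Y ▷ Z ≫ distrib X Y Z = inr _ _ := by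
  rw [distrib, IsIso.comp_inv_eq, inr_desc]

theorem zero_tensor_hom_ext {X Z : C} (f g : (zero : C) ⊗ Z ⟶ X) : f = g :=
  (cancel_epi (fromZero ((zero : C) ⊗ Z))).1 (zero_hom_ext _ _)

theorem coprod_tensor_hom_ext {X Y Z W : C} {f g : (X ⊞ Y) ⊗ Z ⟶ W}
    (hl : inl X Y ▷ Z ≫ f = inl X Y ▷ Z ≫ g) (hr : inr X Y ▷ Z ≫ f = inr X Y ▷ Z ≫ g) : f = g := by
  rw [← cancel_epi (desc (inl X Y ▷ Z) (inr X Y ▷ Z))]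
  refine coprod_hom_ext ?_ ?_
  · rw [reassoc_of% inl_desc, reassoc_of% inl_desc, hl]
  · rw [reassoc_of% inr_desc, reassoc_of% inr_desc, hr]

/-- Maps out of `0 ⊗ Z`, using distributivity. -/
noncomputable def zeroTensorDesc (X Z : C) : (zero : C) ⊗ Z ⟶ X :=
  inv (fromZero ((zero : C) ⊗ Z)) ≫ fromZero X

variable (C) in
/-- The numeral objects `0`, `1`, `1 + 1`, `1 + 1 + 1`, … -/
def num : ℕ → C
  | 0 => zero
  | 1 => 𝟙_ C
  | n + 2 => num (n + 1) ⊞ 𝟙_ C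

/-- The coproduct injections `1 ⟶ 1 + ⋯ + 1`. -/
def pt : {n : ℕ} → Fin n → (𝟙_ C ⟶ num C n)
  | 0 => fun i => i.elim0
  | 1 => fun _ => 𝟙 _
  | _ + 2 => fun i => Fin.lastCases (inr _ _) (fun j => pt j ≫ inl _ _) i

/-- Copairing out of `1 + ⋯ + 1`. -/
def numDesc {X : C} : {n : ℕ} → (Fin n → (𝟙_ C ⟶ X)) → (num C n ⟶ X)
  | 0 => fun _ => fromZero X
  | 1 => fun f => f 0
  | _ + 2 => fun f => desc (numDesc fun i => f i.castSucc) (f (Fin.last _))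

theorem pt_last (n : ℕ) :
    (pt (Fin.last (n + 1)) : 𝟙_ C ⟶ num C (n + 1) ⊞ 𝟙_ C) = inr _ _ :=
  Fin.lastCases_last (motive := fun _ => 𝟙_ C ⟶ num C (n + 2))

theorem pt_castSucc {n : ℕ} (i : Fin (n + 1)) :
    (pt i.castSucc : 𝟙_ C ⟶ num C (n + 1) ⊞ 𝟙_ C) = pt i ≫ inl _ _ :=
  Fin.lastCases_castSucc (motive := fun _ => 𝟙_ C ⟶ num C (n + 2)) i

theorem pt_numDesc {X : C} : {n : ℕ} → (f : Fin n → (𝟙_ C ⟶ X)) → (i : Fin n) →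
    pt i ≫ numDesc f = f i
  | 0, _, i => i.elim0
  | 1, f, i => by
    rw [Subsingleton.elim i 0]
    exact Category.id_comp (f 0)
  | n + 2, f, i => by
    refine Fin.lastCases ?_ (fun j => ?_) i
    · exact (congrArg (· ≫ numDesc f) (pt_last n)).trans (inr_desc _ _)
    · refine (congrArg (· ≫ numDesc f) (pt_castSucc j)).trans ?_
      refine (Category.assoc _ _ _).trans ?_
      exact (congrArg (pt j ≫ ·) (inl_desc _ _)).trans (pt_numDesc _ _)

theorem num_hom_ext {X : C} : {n : ℕ} → {f g : num C n ⟶ X} →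
    (∀ i, pt i ≫ f = pt i ≫ g) → f = g
  | 0, _, _, _ => zero_hom_ext _ _
  | 1, f, g, h => (Category.id_comp (X := 𝟙_ C) f).symm.trans ((h 0).trans (Category.id_comp _))
  | n + 2, f, g, h => by
    refine coprod_hom_ext (X := num C (n + 1)) (num_hom_ext fun i => ?_) ?_
    · have key (p) (hp : p = pt i ≫ inl (num C (n + 1)) (𝟙_ C)) (f : num C (n + 1) ⊞ 𝟙_ C ⟶ X) :
          pt i ≫ inl _ _ ≫ f = p ≫ f := by rw [hp, Category.assoc]
      have hp := pt_castSucc (C := C) i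
      exact (key _ hp f).trans ((h i.castSucc).trans (key _ hp g).symm)
    · have key (p) (hp : p = inr (num C (n + 1)) (𝟙_ C)) (f : num C (n + 1) ⊞ 𝟙_ C ⟶ X) :
          inr _ _ ≫ f = p ≫ f := by rw [hp]
      have hp := pt_last (C := C) n
      exact (key _ hp f).trans ((h (Fin.last _)).trans (key _ hp g).symm)

/-- Maps out of `(1 + ⋯ + 1) ⊗ Z`, using distributivity. -/
noncomputable def tensorDesc {X Z : C} : {n : ℕ} → (Fin n → (𝟙_ C ⊗ Z ⟶ X)) → (num C n ⊗ Z ⟶ X)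
  | 0 => fun _ => zeroTensorDesc X Z
  | 1 => fun f => f 0
  | _ + 2 => fun f =>
    distrib _ _ Z ≫ desc (tensorDesc fun i => f i.castSucc) (f (Fin.last _))

theorem pt_tensorDesc {X Z : C} : {n : ℕ} → (f : Fin n → (𝟙_ C ⊗ Z ⟶ X)) → (i : Fin n) →
    pt i ▷ Z ≫ tensorDesc f = f i
  | 0, _, i => i.elim0
  | 1, f, i => by
    rw [Subsingleton.elim i 0]
    exact (congrArg (· ≫ f 0) (id_whiskerRight (𝟙_ C) Z)).trans (Category.id_comp (f 0))
  | n + 2, f, i => by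
    refine Fin.lastCases ?_ (fun j => ?_) i
    · refine (congrArg (fun h => h ▷ Z ≫ tensorDesc f) (pt_last n)).trans ?_
      exact ((reassoc_of% (inr_distrib (num C (n + 1)) (𝟙_ C) Z)) _).trans (inr_desc _ _)
    · refine (congrArg (fun h => h ▷ Z ≫ tensorDesc f) (pt_castSucc j)).trans ?_
      refine (congrArg (· ≫ tensorDesc f) (comp_whiskerRight _ _ _)).trans ?_
      refine (Category.assoc _ _ _).trans ?_
      refine (congrArg (_ ≫ ·) ((reassoc_of% (inl_distrib (num C (n + 1)) (𝟙_ C) Z)) _)).trans ?_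
      exact (congrArg (_ ≫ ·) (inl_desc _ _)).trans (pt_tensorDesc _ _)

theorem tensor_hom_ext {X Z : C} : {n : ℕ} → {f g : num C n ⊗ Z ⟶ X} →
    (∀ i, pt i ▷ Z ≫ f = pt i ▷ Z ≫ g) → f = g
  | 0, f, g, _ => zero_tensor_hom_ext f g
  | 1, f, g, h => by
    have key (f : 𝟙_ C ⊗ Z ⟶ X) : f = 𝟙 (𝟙_ C) ▷ Z ≫ f := by simp
    exact (key f).trans ((h 0).trans (key g).symm)
  | n + 2, f, g, h => by
    refine coprod_tensor_hom_ext (X := num C (n + 1)) (tensor_hom_ext fun i => ?_) ?_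
    · have key (p) (hp : p = pt i ≫ inl (num C (n + 1)) (𝟙_ C))
          (f : (num C (n + 1) ⊞ 𝟙_ C) ⊗ Z ⟶ X) : pt i ▷ Z ≫ inl _ _ ▷ Z ≫ f = p ▷ Z ≫ f := by
        rw [hp, comp_whiskerRight, Category.assoc]
      have hp := pt_castSucc (C := C) i
      exact (key _ hp f).trans ((h i.castSucc).trans (key _ hp g).symm)
    · have key (p) (hp : p = inr (num C (n + 1)) (𝟙_ C)) (f : (num C (n + 1) ⊞ 𝟙_ C) ⊗ Z ⟶ X) :
          inr _ _ ▷ Z ≫ f = p ▷ Z ≫ f := by rw [hp]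
      have hp := pt_last (C := C) n
      exact (key _ hp f).trans ((h (Fin.last _)).trans (key _ hp g).symm)

theorem tensor_num_hom_ext {X : C} {m n : ℕ} {f g : num C m ⊗ num C n ⟶ X}
    (h : ∀ i j, (pt i ⊗ₘ pt j) ≫ f = (pt i ⊗ₘ pt j) ≫ g) : f = g := by
  refine tensor_hom_ext fun i => ?_
  rw [← cancel_epi (λ_ _).inv]
  refine num_hom_ext fun j => ?_
  have key (f : num C m ⊗ num C n ⟶ X) : pt j ≫ (λ_ _).inv ≫ pt i ▷ _ ≫ f =
      (λ_ (𝟙_ C)).inv ≫ (pt i ⊗ₘ pt j) ≫ f := by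
    rw [tensorHom_def', Category.assoc, leftUnitor_inv_naturality_assoc]
  rw [key, key, h]

variable (C) in
/-- The first numeral is the monoidal unit. -/
def numUnit : 𝟙_ C ≅ num C 1 := Iso.refl _

/-- The canonical isomorphism `m ⊗ n ≅ m * n` for numeral objects, where pairs of indices are
ordered lexicographically. -/
noncomputable def numTensor (m n : ℕ) : num C m ⊗ num C n ≅ num C (m * n) where
  hom := tensorDesc fun i => (λ_ _).hom ≫ numDesc fun j => pt (pr (i, j))
  inv := numDesc fun k => (λ_ _).inv ≫ (pt (pr.symm k).1 ⊗ₘ pt (pr.symm k).2)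
  hom_inv_id := by
    refine tensor_num_hom_ext fun i j => ?_
    rw [tensorHom_def', Category.assoc, reassoc_of% pt_tensorDesc, Category.assoc,
      leftUnitor_naturality_assoc, reassoc_of% pt_numDesc, pt_numDesc, Iso.hom_inv_id_assoc,
      Equiv.symm_apply_apply, Category.comp_id, tensorHom_def']
  inv_hom_id := by
    refine num_hom_ext fun k => ?_
    rw [reassoc_of% pt_numDesc, tensorHom_def', Category.assoc, Category.assoc, pt_tensorDesc,
      leftUnitor_naturality_assoc, pt_numDesc, Iso.inv_hom_id_assoc, Prod.mk.eta,
      Equiv.apply_symm_apply, Category.comp_id]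

theorem pt_numTensor {m n : ℕ} (i : Fin m) (j : Fin n) :
    (pt i ⊗ₘ pt j) ≫ (numTensor m n).hom = (λ_ (𝟙_ C)).hom ≫ pt (pr (i, j)) := by
  rw [tensorHom_def', numTensor, Category.assoc, pt_tensorDesc, leftUnitor_naturality_assoc,
    pt_numDesc]

theorem pt_numTensor_inv {m n : ℕ} (i : Fin m) (j : Fin n) :
    pt (pr (i, j)) ≫ (numTensor m n).inv = (λ_ (𝟙_ C)).inv ≫ (pt i ⊗ₘ pt j) := by
  rw [numTensor, pt_numDesc, Equiv.symm_apply_apply]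

theorem isDeterministic_pt : {n : ℕ} → (i : Fin n) → IsDeterministic (pt i : 𝟙_ C ⟶ num C n)
  | 0, i => i.elim0
  | 1, _ => IsDeterministic.id (𝟙_ C)
  | n + 2, i => by
    refine Fin.lastCases ?_ (fun j => ?_) i
    · have h := isDeterministic_inr (num C (n + 1)) (𝟙_ C)
      rw [← pt_last] at h
      exact h
    · have h := (isDeterministic_pt j).comp (isDeterministic_inl (num C (n + 1)) (𝟙_ C))
      rw [← pt_castSucc] at h
      exact h

theorem isDeterministic_of_pt {n : ℕ} {X : C} (f : num C n ⟶ X)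
    (h : ∀ i, IsDeterministic (pt i ≫ f)) : IsDeterministic f := by
  refine num_hom_ext fun i => ?_
  have h1 := h i
  have h2 : IsDeterministic (pt i : 𝟙_ C ⟶ num C n) := isDeterministic_pt i
  unfold IsDeterministic at h1 h2
  rw [← Category.assoc, h1, ← Category.assoc, h2, Category.assoc, tensorHom_comp_tensorHom]

theorem isDeterministic_numTensor_inv (m n : ℕ) : IsDeterministic (numTensor (C := C) m n).inv :=
  isDeterministic_of_pt _ fun k => by
    have h := pt_numTensor_inv (C := C) (pr.symm k).1 (pr.symm k).2
    rw [Prod.mk.eta, Equiv.apply_symm_apply] at h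
    rw [h]
    exact isDeterministic_leftUnitor_inv.comp ((isDeterministic_pt _).tensor (isDeterministic_pt _))

end Numerals

/-- The category `C_ℕ`: its objects are natural numbers, and its morphisms are the morphisms of `C`
between the numeral objects. -/
structure Numerals (C : Type u) where
  val : ℕ

namespace Numerals

variable {C : Type u} [Category.{v} C] [MonoidalCategory C] [DistributiveMarkovCategory C]

/-- A morphism of `C_ℕ` is a morphism of `C` between numeral objects. -/
@[ext] structure Hom (m n : Numerals C) where
  hom : num C m.val ⟶ num C n.val

instance : Category (Numerals C) where
  Hom := Hom
  id m := ⟨𝟙 (num C m.val)⟩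
  comp f g := ⟨f.hom ≫ g.hom⟩

@[ext] theorem hom_ext {m n : Numerals C} {f g : m ⟶ n} (h : f.hom = g.hom) : f = g := Hom.ext h

@[simp] theorem id_hom (m : Numerals C) : (𝟙 m : m ⟶ m).hom = 𝟙 (num C m.val) := rfl

@[simp] theorem comp_hom {l m n : Numerals C} (f : l ⟶ m) (g : m ⟶ n) :
    (f ≫ g).hom = f.hom ≫ g.hom := rfl

/-- Isomorphisms in `C_ℕ`. -/
@[simps] def isoMk {m n : Numerals C} (e : num C m.val ≅ num C n.val) : m ≅ n where
  hom := ⟨e.hom⟩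
  inv := ⟨e.inv⟩

variable (C) in
/-- The inclusion of `C_ℕ` in `C`. -/
@[simps] def incl : Numerals C ⥤ C where
  obj m := num C m.val
  map f := f.hom

instance : (incl C).Faithful where
  map_injective h := Hom.ext h

noncomputable instance : MonoidalCategoryStruct (Numerals C) where
  tensorObj m n := ⟨m.val * n.val⟩
  tensorUnit := ⟨1⟩
  tensorHom {m m' n n'} f g :=
    ⟨(numTensor m.val n.val).inv ≫ (f.hom ⊗ₘ g.hom) ≫ (numTensor m'.val n'.val).hom⟩
  whiskerLeft m {n n'} f :=
    ⟨(numTensor m.val n.val).inv ≫ (num C m.val ◁ f.hom) ≫ (numTensor m.val n'.val).hom⟩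
  whiskerRight {m m'} f n :=
    ⟨(numTensor m.val n.val).inv ≫ (f.hom ▷ num C n.val) ≫ (numTensor m'.val n.val).hom⟩
  associator l m n := isoMk <|
    ((numTensor _ _).symm ≪≫ ((numTensor l.val m.val).symm ⊗ᵢ .refl _))
        ≪≫ α_ (num C l.val) (num C m.val) (num C n.val)
        ≪≫ ((.refl _ ⊗ᵢ numTensor m.val n.val) ≪≫ numTensor _ _)
  leftUnitor n := isoMk <|
    ((numTensor 1 n.val).symm ≪≫ ((numUnit C).symm ⊗ᵢ .refl _)) ≪≫ λ_ (num C n.val)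
  rightUnitor n := isoMk <|
    ((numTensor n.val 1).symm ≪≫ (.refl _ ⊗ᵢ (numUnit C).symm)) ≪≫ ρ_ (num C n.val)

variable (C) in
/-- The monoidal structure of `C_ℕ` is the one for which the inclusion is strong monoidal. -/
noncomputable def inducingData : Monoidal.InducingFunctorData (incl C) where
  μIso m n := numTensor m.val n.val
  εIso := numUnit C
  whiskerLeft_eq _ _ _ _ := rfl
  whiskerRight_eq _ _ := rfl
  tensorHom_eq _ _ := rfl
  associator_eq _ _ _ := rfl
  leftUnitor_eq _ := rfl
  rightUnitor_eq _ := rfl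

noncomputable instance : MonoidalCategory (Numerals C) :=
  Monoidal.induced (incl C) (inducingData C)

noncomputable instance : (incl C).Monoidal := Monoidal.fromInducedMonoidal (incl C) (inducingData C)

theorem tensorHom_hom {m m' n n' : Numerals C} (f : m ⟶ m') (g : n ⟶ n') : (f ⊗ₘ g).hom =
    (numTensor m.val n.val).inv ≫ (f.hom ⊗ₘ g.hom) ≫ (numTensor m'.val n'.val).hom := rfl

theorem whiskerLeft_hom (m : Numerals C) {n n' : Numerals C} (f : n ⟶ n') : (m ◁ f).hom =
    (numTensor m.val n.val).inv ≫ (num C m.val ◁ f.hom) ≫ (numTensor m.val n'.val).hom := rfl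

theorem whiskerRight_hom {m m' : Numerals C} (f : m ⟶ m') (n : Numerals C) : (f ▷ n).hom =
    (numTensor m.val n.val).inv ≫ (f.hom ▷ num C n.val) ≫ (numTensor m'.val n.val).hom := rfl

theorem associator_hom (l m n : Numerals C) : (α_ l m n).hom.hom =
    (numTensor (l.val * m.val) n.val).inv ≫ ((numTensor l.val m.val).inv ▷ num C n.val) ≫
      (α_ (num C l.val) (num C m.val) (num C n.val)).hom ≫
      (num C l.val ◁ (numTensor m.val n.val).hom) ≫ (numTensor l.val (m.val * n.val)).hom := by
  refine (?_ : (((numTensor _ _).symm ≪≫ ((numTensor l.val m.val).symm ⊗ᵢ .refl _))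
        ≪≫ α_ (num C l.val) (num C m.val) (num C n.val)
        ≪≫ ((.refl _ ⊗ᵢ numTensor m.val n.val) ≪≫ numTensor _ _)).hom = _)
  simp

theorem leftUnitor_inv_hom (n : Numerals C) : (λ_ n).inv.hom =
    (λ_ (num C n.val)).inv ≫ ((numUnit C).hom ▷ num C n.val) ≫ (numTensor 1 n.val).hom := by
  refine (?_ : (((numTensor 1 n.val).symm ≪≫ ((numUnit C).symm ⊗ᵢ .refl _)) ≪≫
    λ_ (num C n.val)).inv = _)
  simp

theorem rightUnitor_inv_hom (n : Numerals C) : (ρ_ n).inv.hom =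
    (ρ_ (num C n.val)).inv ≫ (num C n.val ◁ (numUnit C).hom) ≫ (numTensor n.val 1).hom := by
  refine (?_ : (((numTensor n.val 1).symm ≪≫ (.refl _ ⊗ᵢ (numUnit C).symm)) ≪≫
    ρ_ (num C n.val)).inv = _)
  simp

open Functor.LaxMonoidal

theorem μ_incl (m n : Numerals C) : μ (incl C) m n = (numTensor m.val n.val).hom := rfl

noncomputable instance : BraidedCategory (Numerals C) :=
  BraidedCategory.ofFaithful (incl C)
    (fun m n => isoMk <|
      (numTensor m.val n.val).symm ≪≫ β_ (num C m.val) (num C n.val) ≪≫ numTensor n.val m.val)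
    (fun m n => Iso.hom_inv_id_assoc (numTensor m.val n.val) _)

theorem braiding_hom (m n : Numerals C) : (β_ m n).hom.hom =
    (numTensor m.val n.val).inv ≫ (β_ (num C m.val) (num C n.val)).hom ≫
      (numTensor n.val m.val).hom := rfl

noncomputable instance : (incl C).Braided where
  braided m n := Iso.hom_inv_id_assoc (numTensor m.val n.val) _

noncomputable instance : SymmetricCategory (Numerals C) := SymmetricCategory.ofFaithful (incl C)

noncomputable instance comonObj (n : Numerals C) : ComonObj n where
  counit := Hom.mk (n := ⟨1⟩) (ε[num C n.val] ≫ (numUnit C).hom)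
  comul := Hom.mk (n := ⟨n.val * n.val⟩) (Δ[num C n.val] ≫ (numTensor _ _).hom)
  counit_comul := by
    apply hom_ext
    rw [comp_hom, leftUnitor_inv_hom, whiskerRight_hom, Category.assoc]
    refine (congrArg (_ ≫ ·) (Iso.hom_inv_id_assoc _ _)).trans ?_
    rw [comp_whiskerRight, Category.assoc, ComonObj.counit_comul_assoc]
    rfl
  comul_counit := by
    apply hom_ext
    rw [comp_hom, rightUnitor_inv_hom, whiskerLeft_hom, Category.assoc]
    refine (congrArg (_ ≫ ·) (Iso.hom_inv_id_assoc _ _)).trans ?_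
    rw [MonoidalCategory.whiskerLeft_comp, Category.assoc, ComonObj.comul_counit_assoc]
    rfl
  comul_assoc := by
    apply hom_ext
    rw [comp_hom, comp_hom, comp_hom, whiskerLeft_hom, whiskerRight_hom, associator_hom]
    refine (Category.assoc _ _ _).trans ?_
    refine (congrArg (_ ≫ ·) (Iso.hom_inv_id_assoc _ _)).trans ?_
    refine Eq.trans ?_ (Category.assoc _ _ _).symm
    simp only [Category.assoc]
    refine Eq.trans ?_ (congrArg (_ ≫ ·) (Iso.hom_inv_id_assoc _ _)).symm
    refine Eq.trans ?_ (congrArg (fun t => _ ≫ _ ≫ t) (Iso.hom_inv_id_assoc _ _)).symm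
    simp
    rfl

theorem comul_hom (n : Numerals C) : Δ[n].hom = Δ[num C n.val] ≫ (numTensor n.val n.val).hom := rfl

theorem copy_hom (n : Numerals C) :
    Δ[n].hom = copy (num C n.val) ≫ (numTensor n.val n.val).hom := rfl

theorem eq_to_unit {m : Numerals C} (f g : m ⟶ 𝟙_ (Numerals C)) : f = g := by
  apply hom_ext
  rw [← cancel_mono (numUnit C).inv]
  exact Subsingleton.elim (α := num C m.val ⟶ 𝟙_ C) _ _

noncomputable instance : MarkovCategory (Numerals C) where
  isCommComonObj n :=
    { comul_comm := by
        apply hom_ext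
        rw [comp_hom, braiding_hom, comul_hom]
        simp }
  copy_tensor m n := by
    apply hom_ext
    rw [comp_hom, tensorHom_hom, copy_hom, copy_hom, copy_hom, ← tensorHom_comp_tensorHom]
    have h := tensorμ_comp_μ_tensorHom_μ_comp_μ (incl C) m m n n
    have hd := isDeterministic_numTensor_inv (C := C) m.val n.val
    have h1 : copy (num C (m.val * n.val)) = (numTensor m.val n.val).inv ≫
        (copy (num C m.val) ⊗ₘ copy (num C n.val)) ≫ tensorμ _ _ _ _ ≫
          ((numTensor m.val n.val).hom ⊗ₘ (numTensor m.val n.val).hom) := by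
      rw [← reassoc_of% copy_tensor, reassoc_of% hd]
      simp
    refine (congrArg (· ≫ _) h1).trans ?_
    simp only [Category.assoc]
    exact congrArg (fun t => _ ≫ _ ≫ t) h
  discard_tensor _ _ := eq_to_unit _ _
  copy_unit := by
    apply hom_ext
    rw [comul_hom, leftUnitor_inv_hom]
    refine (congrArg (· ≫ (numTensor 1 1).hom) CopyDiscardCategory.copy_unit).trans ?_
    exact congrArg (_ ≫ ·) ((Category.id_comp _).symm.trans
      (congrArg (· ≫ (numTensor 1 1).hom) (id_whiskerRight (𝟙_ C) (𝟙_ C)).symm))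
  discard_unit := eq_to_unit _ _
  discard_natural _ := eq_to_unit _ _

/-- The morphism of `C_ℕ` given by a function between the sets of indices. -/
def ofFun {m n : Numerals C} (f : Fin m.val → Fin n.val) : m ⟶ n := ⟨numDesc fun i => pt (f i)⟩

theorem pt_ofFun {m n : Numerals C} (f : Fin m.val → Fin n.val) (i : Fin m.val) :
    pt i ≫ (ofFun f : m ⟶ n).hom = pt (f i) := pt_numDesc _ _

theorem isDeterministic_ofFun {m n : Numerals C} (f : Fin m.val → Fin n.val) :
    IsDeterministic (ofFun f : m ⟶ n) := by
  have h : IsDeterministic (ofFun f : m ⟶ n).hom :=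
    isDeterministic_of_pt _ fun i => by rw [pt_ofFun]; exact isDeterministic_pt _
  unfold IsDeterministic at h
  apply hom_ext
  refine (Category.assoc _ _ _).symm.trans ((congrArg (· ≫ _) h).trans ?_)
  refine Eq.trans (Category.assoc _ _ _) (Eq.trans ?_ (Category.assoc _ _ _).symm)
  exact congrArg (_ ≫ ·) (Iso.hom_inv_id_assoc _ _).symm

theorem isIso_ofEquiv {m n : Numerals C} (e : Fin m.val ≃ Fin n.val) :
    IsIso (ofFun e : m ⟶ n) := by
  refine ⟨ofFun e.symm, ?_, ?_⟩
  · refine hom_ext (num_hom_ext fun i => ?_)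
    rw [comp_hom, ← Category.assoc, pt_ofFun, pt_ofFun, Equiv.symm_apply_apply]
    exact (Category.comp_id _).symm
  · refine hom_ext (num_hom_ext fun i => ?_)
    rw [comp_hom, ← Category.assoc, pt_ofFun, pt_ofFun, Equiv.apply_symm_apply]
    exact (Category.comp_id _).symm

/-- Copairing in `C_ℕ`. -/
def copair {m n k : Numerals C} (f : m ⟶ k) (g : n ⟶ k) :
    (⟨m.val + n.val⟩ : Numerals C) ⟶ k :=
  ⟨numDesc fun i => Fin.addCases (fun a => pt a ≫ f.hom) (fun b => pt b ≫ g.hom) i⟩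

theorem ofFun_castAdd_comp_copair {m n k : Numerals C} (f : m ⟶ k) (g : n ⟶ k) :
    ofFun (m := m) (n := ⟨m.val + n.val⟩) (Fin.castAdd n.val) ≫ copair f g = f := by
  refine hom_ext (num_hom_ext fun i => ?_)
  rw [comp_hom, ← Category.assoc, pt_ofFun]
  refine (pt_numDesc _ _).trans ?_
  rw [Fin.addCases_left]

theorem ofFun_natAdd_comp_copair {m n k : Numerals C} (f : m ⟶ k) (g : n ⟶ k) :
    ofFun (m := n) (n := ⟨m.val + n.val⟩) (Fin.natAdd m.val) ≫ copair f g = g := by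
  refine hom_ext (num_hom_ext fun i => ?_)
  rw [comp_hom, ← Category.assoc, pt_ofFun]
  refine (pt_numDesc _ _).trans ?_
  rw [Fin.addCases_right]

theorem copair_uniq {m n k : Numerals C} (h : (⟨m.val + n.val⟩ : Numerals C) ⟶ k) :
    h = copair (ofFun (m := m) (n := ⟨m.val + n.val⟩) (Fin.castAdd n.val) ≫ h)
      (ofFun (m := n) (n := ⟨m.val + n.val⟩) (Fin.natAdd m.val) ≫ h) := by
  refine hom_ext (num_hom_ext fun i => ?_)
  refine Eq.trans ?_ (pt_numDesc _ _).symm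
  refine Fin.addCases (fun a => ?_) (fun b => ?_) i
  · rw [Fin.addCases_left, comp_hom, ← Category.assoc, pt_ofFun]
  · rw [Fin.addCases_right, comp_hom, ← Category.assoc, pt_ofFun]

theorem pt_whiskerRight_ofFun {m m' : Numerals C} (f : Fin m.val → Fin m'.val) (n : Numerals C)
    (i : Fin m.val) (j : Fin n.val) :
    pt (pr (i, j)) ≫ ((ofFun f : m ⟶ m') ▷ n).hom = pt (pr (f i, j)) := by
  rw [whiskerRight_hom, ← Category.assoc, pt_numTensor_inv, tensorHom_def', Category.assoc,
    Category.assoc, ← comp_whiskerRight_assoc, pt_ofFun]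
  rw [← tensorHom_def'_assoc, pt_numTensor, Iso.inv_hom_id_assoc]

noncomputable instance : DistributiveMarkovCategory (Numerals C) where
  zero := ⟨0⟩
  fromZero n := ofFun (m := ⟨0⟩) (n := n) Fin.elim0
  fromZero_uniq f := hom_ext (num_hom_ext fun i => Fin.elim0 i)
  coprod m n := ⟨m.val + n.val⟩
  inl m n := ofFun (m := m) (n := ⟨m.val + n.val⟩) (Fin.castAdd n.val)
  inr m n := ofFun (m := n) (n := ⟨m.val + n.val⟩) (Fin.natAdd m.val)
  desc := copair
  inl_desc := ofFun_castAdd_comp_copair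
  inr_desc := ofFun_natAdd_comp_copair
  desc_uniq := copair_uniq
  isIso_distrib l m n := by
    refine Eq.mpr (congrArg IsIso (?_ : _ = ofFun (m := ⟨l.val * n.val + m.val * n.val⟩)
      (n := ⟨(l.val + m.val) * n.val⟩) (distribEquiv l.val m.val n.val))) (isIso_ofEquiv _)
    refine hom_ext (num_hom_ext fun i => ?_)
    refine (pt_numDesc _ _).trans (Eq.trans ?_ (pt_numDesc _ _).symm)
    refine Fin.addCases (fun a => ?_) (fun b => ?_) i
    · rw [Fin.addCases_left]
      revert a
      refine forall_pr.2 fun a c => ?_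
      exact (pt_whiskerRight_ofFun _ _ _ _).trans (congrArg pt (distribEquiv_castAdd _ _).symm)
    · rw [Fin.addCases_right]
      revert b
      refine forall_pr.2 fun b c => ?_
      exact (pt_whiskerRight_ofFun _ _ _ _).trans (congrArg pt (distribEquiv_natAdd _ _).symm)
  isIso_fromZero n := by
    have h := isIso_ofEquiv (C := C) (m := ⟨0⟩) (n := ⟨0 * n.val⟩) (finCongr (Nat.zero_mul _).symm)
    refine Eq.mpr (congrArg IsIso (?_ : _ = ofFun (m := ⟨0⟩) (n := ⟨0 * n.val⟩)
      (finCongr (Nat.zero_mul n.val).symm))) h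
    exact hom_ext (num_hom_ext fun i => Fin.elim0 i)
  isDeterministic_inl _ _ := isDeterministic_ofFun _
  isDeterministic_inr _ _ := isDeterministic_ofFun _

end Numerals
end GraphonMarkov

namespace GraphonMarkov
open DistributiveMarkovCategory
universe v u v' u'

/-! ### Distributive Markov functors and Bernoulli bases -/

/-- A (strict) distributive Markov functor: it strictly preserves the chosen symmetric monoidal,
comonoid and coproduct structures. (The types of the two sides of each `≍` agree by the
equations on objects.) -/
structure DistributiveMarkovFunctor (C : Type u) [Category.{v} C] [MonoidalCategory C]
    [DistributiveMarkovCategory C] (D : Type u') [Category.{v'} D] [MonoidalCategory D]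
    [DistributiveMarkovCategory D] extends C ⥤ D where
  obj_unit : obj (𝟙_ C) = 𝟙_ D
  obj_tensor (X Y : C) : obj (X ⊗ Y) = obj X ⊗ obj Y
  map_tensor {X X' Y Y' : C} (f : X ⟶ X') (g : Y ⟶ Y') : map (f ⊗ₘ g) ≍ (map f ⊗ₘ map g)
  map_associator (X Y Z : C) : map (α_ X Y Z).hom ≍ (α_ (obj X) (obj Y) (obj Z)).hom
  map_leftUnitor (X : C) : map (λ_ X).hom ≍ (λ_ (obj X)).hom
  map_rightUnitor (X : C) : map (ρ_ X).hom ≍ (ρ_ (obj X)).hom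
  map_braiding (X Y : C) : map (β_ X Y).hom ≍ (β_ (obj X) (obj Y)).hom
  map_copy (X : C) : map (copy X) ≍ copy (obj X)
  map_discard (X : C) : map (discard X) ≍ discard (obj X)
  obj_zero : obj zero = zero
  obj_coprod (X Y : C) : obj (X ⊞ Y) = obj X ⊞ obj Y
  map_inl (X Y : C) : map (inl X Y) ≍ inl (obj X) (obj Y)
  map_inr (X Y : C) : map (inr X Y) ≍ inr (obj X) (obj Y)

/-- A Bernoulli base: a faithful distributive Markov functor from `C_ℕ` to stochastic matrices. -/
structure BernoulliBase (C : Type u) [Category.{v} C] [MonoidalCategory C]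
    [DistributiveMarkovCategory C] extends DistributiveMarkovFunctor (Numerals C) FinStoch where
  faithful {m n : Numerals C} : Function.Injective fun f : m ⟶ n => map f

namespace BernoulliBase

variable {C : Type u} [Category.{v} C] [MonoidalCategory C] [DistributiveMarkovCategory C]

theorem obj_mk (Ψ : BernoulliBase C) (n : ℕ) : Ψ.obj ⟨n⟩ = ⟨n⟩ := by
  induction n with
  | zero => exact Ψ.obj_zero
  | succ n ih =>
    refine (Ψ.obj_coprod ⟨n⟩ (𝟙_ _)).trans ?_
    rw [ih, Ψ.obj_unit]
    rfl

/-- The stochastic matrix of a morphism between numeral objects. -/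
noncomputable def matrix (Ψ : BernoulliBase C) {m n : ℕ} (f : num C m ⟶ num C n) :
    Matrix (Fin m) (Fin n) ℝ :=
  (eqToHom (Ψ.obj_mk m).symm ≫ Ψ.map (X := ⟨m⟩) (Y := ⟨n⟩) ⟨f⟩ ≫ eqToHom (Ψ.obj_mk n)).mat

end BernoulliBase

/-! ### The programming language -/

/-- Types over a set `K` of type constants. -/
inductive Ty (K : Type)
  | const (k : K)
  | unit
  | zero
  | prod (A B : Ty K)
  | sum (A B : Ty K)

/-- The type of booleans. -/
abbrev Ty.bool {K : Type} : Ty K := .sum .unit .unit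

/-- Iterated products `A * (A * ⋯ * (A * unit))`. -/
def Ty.pow {K : Type} (A : Ty K) : ℕ → Ty K
  | 0 => .unit
  | n + 1 => .prod A (Ty.pow A n)

/-- An interface: type constants and typed term constants `f : dom f ⟶ cod f`. -/
structure Interface where
  TyConst : Type
  TmConst : Type
  dom : TmConst → Ty TyConst
  cod : TmConst → Ty TyConst

/-- Variables of type `A` in a context (de Bruijn indices: the head of the list is the variable
bound last). -/
inductive Var {K : Type} : List (Ty K) → Ty K → Type
  | last {Γ : List (Ty K)} {A : Ty K} : Var (A :: Γ) A
  | weaken {Γ : List (Ty K)} {A B : Ty K} (x : Var Γ A) : Var (B :: Γ) A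

/-- Typed terms in context, `Γ ⊢ t : A`. -/
inductive Tm (S : Interface) : List (Ty S.TyConst) → Ty S.TyConst → Type
  | var {Γ A} (x : Var Γ A) : Tm S Γ A
  | unit {Γ} : Tm S Γ .unit
  | pair {Γ A B} (t : Tm S Γ A) (u : Tm S Γ B) : Tm S Γ (.prod A B)
  | fst {Γ A B} (t : Tm S Γ (.prod A B)) : Tm S Γ A
  | snd {Γ A B} (t : Tm S Γ (.prod A B)) : Tm S Γ B
  | inl {Γ A B} (t : Tm S Γ A) : Tm S Γ (.sum A B)
  | inr {Γ A B} (t : Tm S Γ B) : Tm S Γ (.sum A B)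
  | letIn {Γ A B} (t : Tm S Γ A) (u : Tm S (A :: Γ) B) : Tm S Γ B
  | caseZero {Γ B} (t : Tm S Γ .zero) : Tm S Γ B
  | caseSum {Γ A₁ A₂ B} (t : Tm S Γ (.sum A₁ A₂)) (u₁ : Tm S (A₁ :: Γ) B)
      (u₂ : Tm S (A₂ :: Γ) B) : Tm S Γ B
  | const {Γ} (f : S.TmConst) (t : Tm S Γ (S.dom f)) : Tm S Γ (S.cod f)

/-- The program `false`; `bool` is `unit + unit`, with `true` on the left. -/
def Tm.false {S : Interface} {Γ : List (Ty S.TyConst)} : Tm S Γ .bool := .inr .unit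

/-- Iterated pairing. -/
def Tm.tuple {S : Interface} {Γ : List (Ty S.TyConst)} {A : Ty S.TyConst} :
    (n : ℕ) → (Fin n → Tm S Γ A) → Tm S Γ (A.pow n)
  | 0, _ => .unit
  | n + 1, t => .pair (t 0) (Tm.tuple n fun i => t i.succ)

section Interpretation

variable {C : Type u} [Category.{v} C] [MonoidalCategory C] [DistributiveMarkovCategory C]

/-- The object interpreting a type, given objects interpreting the type constants. -/
def Ty.interp {K : Type} (obj : K → C) : Ty K → C
  | .const k => obj k
  | .unit => 𝟙_ C
  | .zero => DistributiveMarkovCategory.zero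
  | .prod A B => A.interp obj ⊗ B.interp obj
  | .sum A B => A.interp obj ⊞ B.interp obj

/-- The object interpreting a context. -/
def ctxInterp {K : Type} (obj : K → C) : List (Ty K) → C
  | [] => 𝟙_ C
  | A :: Γ => ctxInterp obj Γ ⊗ A.interp obj

/-- The morphism interpreting a variable: a projection. -/
def Var.interp {K : Type} (obj : K → C) {Γ : List (Ty K)} {A : Ty K} :
    Var Γ A → (ctxInterp obj Γ ⟶ A.interp obj)
  | .last (Γ := Γ) (A := A) => discard (ctxInterp obj Γ) ▷ A.interp obj ≫ (λ_ _).hom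
  | .weaken (Γ := Γ) (B := B) x =>
    ctxInterp obj Γ ◁ discard (B.interp obj) ≫ (ρ_ _).hom ≫ x.interp obj

variable (C) in
/-- An interpretation of an interface: objects for the type constants and morphisms for the term
constants. -/
structure Interp (S : Interface) where
  obj : S.TyConst → C
  hom (f : S.TmConst) : (S.dom f).interp obj ⟶ (S.cod f).interp obj

/-- The isomorphism `Z ⊗ (X + Y) ⟶ Z ⊗ X + Z ⊗ Y`, inverse to the canonical map. -/
noncomputable def distribLeft (Z X Y : C) : Z ⊗ (X ⊞ Y) ⟶ (Z ⊗ X) ⊞ (Z ⊗ Y) :=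
  (β_ Z (X ⊞ Y)).hom ≫ distrib X Y Z ≫
    desc ((β_ X Z).hom ≫ inl (Z ⊗ X) (Z ⊗ Y)) ((β_ Y Z).hom ≫ inr (Z ⊗ X) (Z ⊗ Y))

theorem whiskerLeft_inl_distribLeft (Z X Y : C) :
    Z ◁ inl X Y ≫ distribLeft Z X Y = inl (Z ⊗ X) (Z ⊗ Y) := by
  rw [distribLeft, BraidedCategory.braiding_naturality_right_assoc, reassoc_of% inl_distrib,
    inl_desc, SymmetricCategory.symmetry_assoc]

theorem whiskerLeft_inr_distribLeft (Z X Y : C) :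
    Z ◁ inr X Y ≫ distribLeft Z X Y = inr (Z ⊗ X) (Z ⊗ Y) := by
  rw [distribLeft, BraidedCategory.braiding_naturality_right_assoc, reassoc_of% inr_distrib,
    inr_desc, SymmetricCategory.symmetry_assoc]

/-- The morphism interpreting a typed term in context. -/
noncomputable def Interp.term {S : Interface} (M : Interp C S) {Γ : List (Ty S.TyConst)}
    {A : Ty S.TyConst} : Tm S Γ A → (ctxInterp M.obj Γ ⟶ A.interp M.obj)
  | .var x => x.interp M.obj
  | .unit => discard _
  | .pair t u => copy _ ≫ (M.term t ⊗ₘ M.term u)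
  | .fst (A := A) (B := B) t =>
    M.term t ≫ A.interp M.obj ◁ discard (B.interp M.obj) ≫ (ρ_ (A.interp M.obj)).hom
  | .snd (A := A) (B := B) t =>
    M.term t ≫ discard (A.interp M.obj) ▷ B.interp M.obj ≫ (λ_ (B.interp M.obj)).hom
  | .inl t => M.term t ≫ DistributiveMarkovCategory.inl _ _
  | .inr t => M.term t ≫ DistributiveMarkovCategory.inr _ _
  | .letIn (Γ := Γ) t u => copy _ ≫ ctxInterp M.obj Γ ◁ M.term t ≫ M.term u
  | .caseZero t => M.term t ≫ fromZero _
  | .caseSum (Γ := Γ) t u₁ u₂ =>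
    copy _ ≫ ctxInterp M.obj Γ ◁ M.term t ≫ distribLeft _ _ _ ≫ desc (M.term u₁) (M.term u₂)
  | .const f t => M.term t ≫ M.hom f

end Interpretation

/-! ### Numeral types and observation -/

namespace Ty

variable {K : Type}

/-- A type is numeral if it is formed without type constants. -/
def IsNumeral : Ty K → Prop
  | .const _ => False
  | .unit => True
  | .zero => True
  | .prod A B => A.IsNumeral ∧ B.IsNumeral
  | .sum A B => A.IsNumeral ∧ B.IsNumeral

/-- The number of values of a numeral type (with a dummy value for type constants). -/
def size : Ty K → ℕ
  | .const _ => 0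
  | .unit => 1
  | .zero => 0
  | .prod A B => A.size * B.size
  | .sum A B => A.size + B.size

/-- The finite set of values of a numeral type (with a dummy value for type constants). -/
def Val : Ty K → Type
  | .const _ => Empty
  | .unit => Unit
  | .zero => Empty
  | .prod A B => A.Val × B.Val
  | .sum A B => A.Val ⊕ B.Val

/-- The enumeration of the values of a numeral type. -/
def index : (A : Ty K) → A.Val → Fin A.size
  | .const _ => Empty.elim
  | .unit => fun _ => (0 : Fin 1)
  | .zero => Empty.elim
  | .prod A B => fun v => pr (A.index v.1, B.index v.2)
  | .sum A B => Sum.elim (fun v => Fin.castAdd B.size (A.index v))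
      (fun v => Fin.natAdd A.size (B.index v))

/-- The canonical isomorphism from a numeral type to a numeral object. -/
noncomputable def toNum {C : Type u} [Category.{v} C] [MonoidalCategory C]
    [DistributiveMarkovCategory C] (obj : K → C) :
    (A : Ty K) → A.IsNumeral → (A.interp obj ⟶ num C A.size)
  | .const _ => fun h => h.elim
  | .unit => fun _ => (numUnit C).hom
  | .zero => fun _ => 𝟙 (DistributiveMarkovCategory.zero : C)
  | .prod A B => fun h => (A.toNum obj h.1 ⊗ₘ B.toNum obj h.2) ≫ (numTensor A.size B.size).hom
  | .sum A B => fun h => desc (A.toNum obj h.1 ≫ numDesc fun i => pt (Fin.castAdd B.size i))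
      (B.toNum obj h.2 ≫ numDesc fun i => pt (Fin.natAdd A.size i))

theorem isNumeral_pow {A : Ty K} (hA : A.IsNumeral) : (n : ℕ) → (A.pow n).IsNumeral
  | 0 => trivial
  | n + 1 => ⟨hA, isNumeral_pow hA n⟩

/-- Booleans as values; `bool` is `unit + unit`, with `true` on the left. -/
def boolVal (b : Bool) : (bool : Ty K).Val := if b then Sum.inl () else Sum.inr ()

/-- Tuples as values. -/
def tupleVal {A : Ty K} : {n : ℕ} → (Fin n → A.Val) → (A.pow n).Val
  | 0, _ => ()
  | _ + 1, v => (v 0, tupleVal fun i => v i.succ)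

end Ty

/-- The probability that a closed program of numeral type returns the value `v`, according to a
Bernoulli base `Ψ`. -/
noncomputable def BernoulliBase.prob {C : Type u} [Category.{v} C] [MonoidalCategory C]
    [DistributiveMarkovCategory C] (Ψ : BernoulliBase C) {S : Interface} (M : Interp C S)
    {A : Ty S.TyConst} (hA : A.IsNumeral) (t : Tm S [] A) (v : A.Val) : ℝ :=
  Ψ.matrix ((numUnit C).inv ≫ M.term t ≫ A.toNum M.obj hA) 0 (A.index v)

/-! ### The graph interface -/

/-- The term constants of the graph interface. -/
inductive GraphConst
  | new
  | edge

/-- The graph interface, with a type constant `vertex` and term constants `new : unit ⟶ vertex` and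
`edge : vertex * vertex ⟶ bool`. -/
@[reducible] def graphInterface : Interface where
  TyConst := Unit
  TmConst := GraphConst
  dom
    | .new => .unit
    | .edge => .prod (.const ()) (.const ())
  cod
    | .new => .const ()
    | .edge => .bool

/-- The type constant `vertex`. -/
abbrev vertex : Ty graphInterface.TyConst := .const ()

/-- The program `new()`. -/
def newTm {Γ : List (Ty Unit)} : Tm graphInterface Γ vertex :=
  Tm.const (S := graphInterface) GraphConst.new .unit

/-- The program `edge(t, u)`. -/
def edgeTm {Γ : List (Ty Unit)} (t u : Tm graphInterface Γ vertex) : Tm graphInterface Γ .bool :=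
  Tm.const (S := graphInterface) GraphConst.edge (.pair t u)

/-- The `i`-th of `n` vertices in context, in the order in which they have been bound. -/
def nthVertex : {n : ℕ} → Fin n → Var (List.replicate n vertex) vertex
  | 0, i => i.elim0
  | _ + 1, i => Fin.lastCases .last (fun j => .weaken (nthVertex j)) i

/-- The program `let x₁ = new() in … let xₙ = new() in t`. -/
def letNew {A : Ty Unit} :
    (n : ℕ) → Tm graphInterface (List.replicate n vertex) A → Tm graphInterface [] A
  | 0, t => t
  | n + 1, t => letNew n (.letIn newTm t)

/-- The program `tₙ`, of type `bool ^ (n * n)`, which creates `n` vertices and returns the matrix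
of all `edge(xᵢ, xⱼ)`. -/
def graphProgram (n : ℕ) : Tm graphInterface [] ((Ty.bool.pow n).pow n) :=
  letNew n <| Tm.tuple n fun i => Tm.tuple n fun j =>
    edgeTm (.var (nthVertex i)) (.var (nthVertex j))

theorem isNumeral_matrix (n : ℕ) : (((Ty.bool : Ty Unit).pow n).pow n).IsNumeral :=
  Ty.isNumeral_pow (A := (Ty.bool : Ty Unit).pow n) (Ty.isNumeral_pow (A := Ty.bool) ⟨trivial, trivial⟩ n) n

/-- A matrix of booleans as a value. -/
def matrixVal {n : ℕ} (a : Fin n → Fin n → Bool) : (((Ty.bool : Ty Unit).pow n).pow n).Val :=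
  Ty.tupleVal fun i => Ty.tupleVal fun j => Ty.boolVal (a i j)

/-- The requirements on an interpretation of the graph interface: graphs are simple and undirected,
`x : vertex ⊢ edge(x, x) ≡ false` and `x, y : vertex ⊢ edge(x, y) ≡ edge(y, x)`, and `edge` is
deterministic. -/
structure IsGraphTheory {C : Type u} [Category.{v} C] [MonoidalCategory C]
    [DistributiveMarkovCategory C] (M : Interp C graphInterface) : Prop where
  irrefl : M.term (Γ := [vertex]) (edgeTm (.var .last) (.var .last)) =
    M.term (Γ := [vertex]) Tm.false
  symm : M.term (Γ := [vertex, vertex]) (edgeTm (.var (.weaken .last)) (.var .last)) =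
    M.term (Γ := [vertex, vertex]) (edgeTm (.var .last) (.var (.weaken .last)))
  deterministic : IsDeterministic (M.hom GraphConst.edge)

/-! ### Graphons -/

/-- A graphon: a symmetric measurable function `[0,1]² ⟶ [0,1]`. -/
structure Graphon where
  toFun : unitInterval → unitInterval → unitInterval
  symm' (x y : unitInterval) : toFun x y = toFun y x
  measurable' : Measurable (Function.uncurry toFun)

/-- Adjacency matrices of simple undirected graphs. -/
def IsAdjMatrix {n : ℕ} (a : Fin n → Fin n → Bool) : Prop :=
  (∀ i, a i i = false) ∧ ∀ i j, a i j = a j i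

open Classical in
/-- The random graph model `p_{W,n}` of a graphon `W`, as a distribution on `n × n` matrices: sample
`x₁, …, xₙ` uniformly from `[0,1]` and include each edge `{i, j}` with probability `W(xᵢ, xⱼ)`. -/
noncomputable def Graphon.model (W : Graphon) (n : ℕ) (a : Fin n → Fin n → Bool) : ℝ :=
  if IsAdjMatrix a then
    ∫ x : Fin n → unitInterval, ∏ i : Fin n, ∏ j ∈ Finset.Ioi i,
      if a i j then (W.toFun (x i) (x j) : ℝ) else 1 - (W.toFun (x i) (x j) : ℝ)
  else 0

end GraphonMarkov

open GraphonMarkov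

/-! The map `edge` has to be deterministic although W may take values strictly between 0 and 1, so
the randomness of the edges must come from the vertices. A finite simple graph does give a model in
`FinStoch`, with `new` a uniformly random vertex and `edge` the adjacency function. But vertices are
then drawn with replacement and may coincide, and the program returns the densities of that one
graph. The remedy is to pass to a limit of finite graphs at the level of categories.

The category is a quotient of sequences in `FinStoch`: morphisms are sequences of stochastic
matrices, identified when the largest ℓ¹-distance between corresponding rows tends to 0 along a
nonprincipal ultrafilter. Under composition and tensor these distances add, with no factor depending
on the sizes of the matrices (`sum_abs_mul_sub_mul_le`). So the operations descend to classes even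
though the sizes may grow, and every law holds termwise.

A numeral object is a constant sequence, so a morphism between numerals is a sequence of matrices of
one fixed size with entries in [0,1]. By compactness it has a limit along the ultrafilter
(`exists_tendsto_ultra`), and the limit determines the morphism (`limMat_injective`). Taking limits
is therefore a faithful functor to `FinStoch`, and this is the Bernoulli base.

A sequence of finite simple graphs now yields an interpretation of the graph interface. The two
equations hold in each graph separately, and the distribution of the program is the limit of the
densities of the graphs (`AsympStoch.prob_graphProgram`). It remains to find graphs whose densities
converge to the random graph model of W.

This is a second moment argument. Sample a graph on M vertices from W. Disjoint tuples of distinct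
vertices show a given pattern independently, each with the probability p of the model
(`Graphon.integral_pattern_mul_pattern`). All other pairs of n-tuples form a fraction of at most
(2n)²/M, by a birthday estimate (`card_not_injective_le`). So the mean square deviation of the
density from p is at most (2n)²/M. For large M some outcome approximates all patterns on at most m
vertices at once (`Graphon.exists_finGraph`), and letting m grow gives the sequence. -/

namespace GraphonMarkov
open DistributiveMarkovCategory

/-! ### Row-wise ℓ¹-distance of stochastic matrices -/

namespace FinStoch

/-- Two stochastic matrices are `r`-close if all their rows are at `ℓ¹`-distance at most `r`. -/
def Close {m n : FinStoch} (r : ℝ) (f g : m ⟶ n) : Prop :=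
  ∀ i, ∑ j, |f.mat i j - g.mat i j| ≤ r

theorem Close.refl {m n : FinStoch} {r : ℝ} (hr : 0 ≤ r) (f : m ⟶ n) : Close r f f :=
  fun i => by simpa using hr

theorem Close.symm {m n : FinStoch} {r : ℝ} {f g : m ⟶ n} (h : Close r f g) : Close r g f :=
  fun i => by simpa only [abs_sub_comm] using h i

theorem Close.trans {m n : FinStoch} {r s : ℝ} {f g h : m ⟶ n} (h₁ : Close r f g)
    (h₂ : Close s g h) : Close (r + s) f h := fun i => by
  refine le_trans ?_ (add_le_add (h₁ i) (h₂ i))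
  rw [← Finset.sum_add_distrib]
  exact Finset.sum_le_sum fun j _ => abs_sub_le _ _ _

/-- Compare through the hybrid a'b: ab − a'b' = (a − a')b + a'(b − b'). Since b(i, ·) and a' have
total mass 1, each part costs only its own distance, whatever the sizes of the index sets. Both
composition and tensor reduce to this estimate. -/
theorem sum_abs_mul_sub_mul_le {ι κ : Type*} [Fintype ι] [Fintype κ] {r s : ℝ} {a a' : ι → ℝ}
    {b b' : ι → κ → ℝ} (ha' : ∀ i, 0 ≤ a' i) (hb : ∀ i j, 0 ≤ b i j) (ha's : ∑ i, a' i = 1)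
    (hbs : ∀ i, ∑ j, b i j = 1) (h : ∑ i, |a i - a' i| ≤ r)
    (h' : ∀ i, ∑ j, |b i j - b' i j| ≤ s) :
    ∑ i, ∑ j, |a i * b i j - a' i * b' i j| ≤ r + s := by
  have key (i) : ∑ j, |a i * b i j - a' i * b' i j| ≤ |a i - a' i| + a' i * s := by
    calc ∑ j, |a i * b i j - a' i * b' i j|
        ≤ ∑ j, (|a i - a' i| * b i j + a' i * |b i j - b' i j|) := by
          refine Finset.sum_le_sum fun j _ => ?_
          have : a i * b i j - a' i * b' i j =
            (a i - a' i) * b i j + a' i * (b i j - b' i j) := by ring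
          rw [this]
          refine (abs_add_le _ _).trans ?_
          rw [abs_mul, abs_mul, abs_of_nonneg (hb i j), abs_of_nonneg (ha' i)]
      _ = |a i - a' i| + a' i * ∑ j, |b i j - b' i j| := by
          rw [Finset.sum_add_distrib, ← Finset.mul_sum, ← Finset.mul_sum, hbs, mul_one]
      _ ≤ _ := by gcongr; exacts [ha' i, h' i]
  refine (Finset.sum_le_sum fun i _ => key i).trans ?_
  rw [Finset.sum_add_distrib, ← Finset.sum_mul, ha's, one_mul]
  exact add_le_add h le_rfl

/-- Forgetting the intermediate index of the joint distribution can only decrease the ℓ¹-distance,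
by the triangle inequality. -/
theorem Close.comp {l m n : FinStoch} {r s : ℝ} {f f' : l ⟶ m} {g g' : m ⟶ n} (h : Close r f f')
    (h' : Close s g g') : Close (r + s) (f ≫ g) (f' ≫ g') := fun i => by
  refine le_trans ?_ (sum_abs_mul_sub_mul_le (f'.nonneg i) g.nonneg (f'.row_sum i) g.row_sum
    (h i) h')
  rw [Finset.sum_comm]
  refine Finset.sum_le_sum fun j _ => ?_
  rw [comp_apply, comp_apply, ← Finset.sum_sub_distrib]
  exact Finset.abs_sum_le_sum_abs _ _

theorem Close.tensor {m m' n n' : FinStoch} {r s : ℝ} {f f' : m ⟶ m'} {g g' : n ⟶ n'}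
    (h : Close r f f') (h' : Close s g g') : Close (r + s) (f ⊗ₘ g) (f' ⊗ₘ g') := by
  refine forall_pr.2 fun i k => ?_
  refine le_of_eq_of_le ?_ (sum_abs_mul_sub_mul_le (f'.nonneg i) (fun _ => g.nonneg k)
    (f'.row_sum i) (fun _ => g.row_sum k) (h i) (fun _ => h' k))
  refine (sum_pr _).trans ?_
  simp_rw [tensorHom_apply]

theorem Close.copair {m n k : FinStoch} {r : ℝ} {f f' : m ⟶ k} {g g' : n ⟶ k}
    (h : Close r f f') (h' : Close r g g') : Close r (copair f g) (copair f' g') := fun i => by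
  refine Fin.addCases (fun a => ?_) (fun b => ?_) i
  · simpa [FinStoch.copair] using h a
  · simpa [FinStoch.copair] using h' b

end FinStoch

/-! ### The distributive Markov category of asymptotic stochastic matrices -/

/-- The category of asymptotic stochastic matrices: its objects are sequences of finite sets. -/
structure AsympStoch where
  obj : ℕ → FinStoch

namespace AsympStoch

/-- The ultrafilter on `ℕ` along which limits are taken. -/
noncomputable abbrev ultra : Ultrafilter ℕ := Filter.hyperfilter ℕ

/-- Sequences of stochastic matrices are identified if their uniform row distance tends to `0` along
the ultrafilter. -/
def homSetoid (X Y : AsympStoch) : Setoid (∀ N, X.obj N ⟶ Y.obj N) where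
  r F G := ∀ r > 0, ∀ᶠ N in ultra, FinStoch.Close r (F N) (G N)
  iseqv :=
    { refl := fun _ _ hr => .of_forall fun _ => .refl hr.le _
      symm := fun h r hr => (h r hr).mono fun _ h => h.symm
      trans := fun h h' r hr => by
        filter_upwards [h (r / 2) (half_pos hr), h' (r / 2) (half_pos hr)] with N h h'
        exact add_halves r ▸ h.trans h' }

/-- A morphism is a sequence of stochastic matrices, up to asymptotic equality. -/
def Hom (X Y : AsympStoch) : Type := Quotient (homSetoid X Y)

/-- The morphism of a sequence of stochastic matrices. -/
def Hom.mk {X Y : AsympStoch} (F : ∀ N, X.obj N ⟶ Y.obj N) : Hom X Y :=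
  Quotient.mk (homSetoid X Y) F

theorem Hom.exists_eq_mk {X Y : AsympStoch} (f : Hom X Y) : ∃ F, f = Hom.mk F := by
  obtain ⟨F⟩ := f
  exact ⟨F, rfl⟩

/-- Here and in the instances below, the only analytic content is that the operations respect
asymptotic equality, which is the matching `Close` lemma. The axioms hold already for
representatives, term by term. -/
noncomputable instance : Category AsympStoch where
  Hom := Hom
  id X := Hom.mk fun N => 𝟙 (X.obj N)
  comp f g := Quotient.map₂ (fun F G N => F N ≫ G N) (fun _ _ h _ _ h' r hr => by
    filter_upwards [h (r / 2) (half_pos hr), h' (r / 2) (half_pos hr)] with N h h'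
    exact add_halves r ▸ h.comp h') f g
  id_comp := by
    intro X Y f₁
    obtain ⟨F, rfl⟩ := Hom.exists_eq_mk f₁
    exact congrArg Hom.mk (funext fun N => Category.id_comp _)
  comp_id := by
    intro X Y f₁
    obtain ⟨F, rfl⟩ := Hom.exists_eq_mk f₁
    exact congrArg Hom.mk (funext fun N => Category.comp_id _)
  assoc := by
    intro X Y Z W f₁ f₂ f₃
    obtain ⟨F, rfl⟩ := Hom.exists_eq_mk f₁
    obtain ⟨G, rfl⟩ := Hom.exists_eq_mk f₂
    obtain ⟨H, rfl⟩ := Hom.exists_eq_mk f₃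
    exact congrArg Hom.mk (funext fun N => Category.assoc _ _ _)

/-- The morphism of a sequence of stochastic matrices. -/
def ofSeq {X Y : AsympStoch} (F : ∀ N, X.obj N ⟶ Y.obj N) : X ⟶ Y := Hom.mk F

theorem exists_eq_ofSeq {X Y : AsympStoch} (f : X ⟶ Y) : ∃ F, f = ofSeq F := Hom.exists_eq_mk f

theorem ofSeq_eq_iff {X Y : AsympStoch} {F G : ∀ N, X.obj N ⟶ Y.obj N} :
    ofSeq F = ofSeq G ↔ ∀ r > 0, ∀ᶠ N in ultra, FinStoch.Close r (F N) (G N) :=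
  Quotient.eq (r := homSetoid X Y)

theorem ofSeq_congr {X Y : AsympStoch} {F G : ∀ N, X.obj N ⟶ Y.obj N} (h : ∀ N, F N = G N) :
    ofSeq F = ofSeq G := congrArg ofSeq (funext h)

theorem ofSeq_comp {X Y Z : AsympStoch} (F : ∀ N, X.obj N ⟶ Y.obj N) (G : ∀ N, Y.obj N ⟶ Z.obj N) :
    ofSeq F ≫ ofSeq G = ofSeq fun N => F N ≫ G N := rfl

/-- A sequence of isomorphisms is an isomorphism. -/
def isoOfSeq {X Y : AsympStoch} (e : ∀ N, X.obj N ≅ Y.obj N) : X ≅ Y where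
  hom := ofSeq fun N => (e N).hom
  inv := ofSeq fun N => (e N).inv
  hom_inv_id := ofSeq_congr fun N => (e N).hom_inv_id
  inv_hom_id := ofSeq_congr fun N => (e N).inv_hom_id

noncomputable instance : MonoidalCategoryStruct AsympStoch where
  tensorObj X Y := ⟨fun N => X.obj N ⊗ Y.obj N⟩
  tensorUnit := ⟨fun _ => 𝟙_ FinStoch⟩
  tensorHom {X X' Y Y'} f g := Quotient.map₂ (sa := homSetoid X X') (sb := homSetoid Y Y')
    (sc := homSetoid ⟨fun N => X.obj N ⊗ Y.obj N⟩ ⟨fun N => X'.obj N ⊗ Y'.obj N⟩)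
    (fun F G N => F N ⊗ₘ G N)
    (fun _ _ h _ _ h' r hr => by
      filter_upwards [h (r / 2) (half_pos hr), h' (r / 2) (half_pos hr)] with N h h'
      exact add_halves r ▸ h.tensor h') f g
  whiskerLeft X {Y Y'} g := Quotient.map (sa := homSetoid Y Y')
    (sb := homSetoid ⟨fun N => X.obj N ⊗ Y.obj N⟩ ⟨fun N => X.obj N ⊗ Y'.obj N⟩)
    (fun G N => X.obj N ◁ G N)
    (fun _ _ h r hr => by
      filter_upwards [h r hr] with N h
      -- Whiskering is tensoring with an identity, which is at distance 0 from itself.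
      exact zero_add r ▸ (FinStoch.Close.refl le_rfl (𝟙 (X.obj N))).tensor h) g
  whiskerRight {X X'} f Y := Quotient.map (sa := homSetoid X X')
    (sb := homSetoid ⟨fun N => X.obj N ⊗ Y.obj N⟩ ⟨fun N => X'.obj N ⊗ Y.obj N⟩)
    (fun F N => F N ▷ Y.obj N)
    (fun _ _ h r hr => by
      filter_upwards [h r hr] with N h
      exact add_zero r ▸ h.tensor (FinStoch.Close.refl le_rfl (𝟙 (Y.obj N)))) f
  associator X Y Z := isoOfSeq (X := ⟨fun N => (X.obj N ⊗ Y.obj N) ⊗ Z.obj N⟩)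
    (Y := ⟨fun N => X.obj N ⊗ Y.obj N ⊗ Z.obj N⟩) fun N => α_ (X.obj N) (Y.obj N) (Z.obj N)
  leftUnitor X := isoOfSeq (X := ⟨fun N => 𝟙_ FinStoch ⊗ X.obj N⟩) fun N => λ_ (X.obj N)
  rightUnitor X := isoOfSeq (X := ⟨fun N => X.obj N ⊗ 𝟙_ FinStoch⟩) fun N => ρ_ (X.obj N)

noncomputable instance : MonoidalCategory AsympStoch where
  tensorHom_def := by
    intro X Y Z W f₁ f₂
    obtain ⟨F, rfl⟩ := exists_eq_ofSeq f₁
    obtain ⟨G, rfl⟩ := exists_eq_ofSeq f₂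
    exact ofSeq_congr fun N => tensorHom_def _ _
  id_tensorHom_id X Y := ofSeq_congr fun N => id_tensorHom_id _ _
  tensorHom_comp_tensorHom := by
    intro X₁ Y₁ Z₁ X₂ Y₂ Z₂ f₁ f₂ f₃ f₄
    obtain ⟨F, rfl⟩ := exists_eq_ofSeq f₁
    obtain ⟨F', rfl⟩ := exists_eq_ofSeq f₂
    obtain ⟨G, rfl⟩ := exists_eq_ofSeq f₃
    obtain ⟨G', rfl⟩ := exists_eq_ofSeq f₄
    exact ofSeq_congr fun N => tensorHom_comp_tensorHom _ _ _ _
  whiskerLeft_id X Y := ofSeq_congr fun N => whiskerLeft_id _ _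
  id_whiskerRight X Y := ofSeq_congr fun N => id_whiskerRight _ _
  associator_naturality := by
    intro X₁ X₂ X₃ Y₁ Y₂ Y₃ f₁ f₂ f₃
    obtain ⟨F, rfl⟩ := exists_eq_ofSeq f₁
    obtain ⟨G, rfl⟩ := exists_eq_ofSeq f₂
    obtain ⟨H, rfl⟩ := exists_eq_ofSeq f₃
    exact ofSeq_congr fun N => associator_naturality _ _ _
  leftUnitor_naturality := by
    intro X Y f₁
    obtain ⟨F, rfl⟩ := exists_eq_ofSeq f₁
    exact ofSeq_congr fun N => leftUnitor_naturality _
  rightUnitor_naturality := by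
    intro X Y f₁
    obtain ⟨F, rfl⟩ := exists_eq_ofSeq f₁
    exact ofSeq_congr fun N => rightUnitor_naturality _
  pentagon W X Y Z := ofSeq_congr fun N => pentagon _ _ _ _
  triangle X Y := ofSeq_congr fun N => triangle _ _

noncomputable instance : SymmetricCategory AsympStoch where
  braiding X Y := isoOfSeq (X := ⟨fun N => X.obj N ⊗ Y.obj N⟩) (Y := ⟨fun N => Y.obj N ⊗ X.obj N⟩)
    fun N => β_ (X.obj N) (Y.obj N)
  braiding_naturality_right := by
    intro X Y Z f₁
    obtain ⟨F, rfl⟩ := exists_eq_ofSeq f₁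
    exact ofSeq_congr fun N => BraidedCategory.braiding_naturality_right _ _
  braiding_naturality_left := by
    intro X Y f₁ Z
    obtain ⟨F, rfl⟩ := exists_eq_ofSeq f₁
    exact ofSeq_congr fun N => BraidedCategory.braiding_naturality_left _ _
  hexagon_forward X Y Z := ofSeq_congr fun N => BraidedCategory.hexagon_forward _ _ _
  hexagon_reverse X Y Z := ofSeq_congr fun N => BraidedCategory.hexagon_reverse _ _ _
  symmetry X Y := ofSeq_congr fun N => SymmetricCategory.symmetry _ _

noncomputable instance comonObj (X : AsympStoch) : ComonObj X where
  counit := ofSeq (Y := ⟨fun _ => 𝟙_ FinStoch⟩) fun N => ε[X.obj N]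
  comul := ofSeq (Y := ⟨fun N => X.obj N ⊗ X.obj N⟩) fun N => Δ[X.obj N]
  counit_comul := ofSeq_congr fun _ => ComonObj.counit_comul _
  comul_counit := ofSeq_congr fun _ => ComonObj.comul_counit _
  comul_assoc := ofSeq_congr fun _ => ComonObj.comul_assoc _

noncomputable instance : MarkovCategory AsympStoch where
  isCommComonObj X := { comul_comm := ofSeq_congr fun N => IsCommComonObj.comul_comm _ }
  copy_tensor X Y := ofSeq_congr fun N => CopyDiscardCategory.copy_tensor _ _
  discard_tensor X Y := ofSeq_congr fun N => CopyDiscardCategory.discard_tensor _ _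
  copy_unit := ofSeq_congr fun N => CopyDiscardCategory.copy_unit
  discard_unit := ofSeq_congr fun N => CopyDiscardCategory.discard_unit
  discard_natural := by
    intro X Y f₁
    obtain ⟨F, rfl⟩ := exists_eq_ofSeq f₁
    exact ofSeq_congr fun N => MarkovCategory.discard_natural _

noncomputable instance : DistributiveMarkovCategory AsympStoch where
  zero := ⟨fun _ => zero⟩
  fromZero X := ofSeq (X := ⟨fun _ => zero⟩) fun N => fromZero (X.obj N)
  fromZero_uniq := by
    intro X f₁
    obtain ⟨F, rfl⟩ := exists_eq_ofSeq f₁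
    exact ofSeq_congr fun N => fromZero_uniq _
  coprod X Y := ⟨fun N => X.obj N ⊞ Y.obj N⟩
  inl X Y := ofSeq (Y := ⟨fun N => X.obj N ⊞ Y.obj N⟩) fun N => inl (X.obj N) (Y.obj N)
  inr X Y := ofSeq (Y := ⟨fun N => X.obj N ⊞ Y.obj N⟩) fun N => inr (X.obj N) (Y.obj N)
  desc {X Y Z} f g := Quotient.map₂ (sa := homSetoid X Z) (sb := homSetoid Y Z)
    (sc := homSetoid ⟨fun N => X.obj N ⊞ Y.obj N⟩ Z) (fun F G N => desc (F N) (G N))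
    (fun _ _ h _ _ h' r hr => by
      filter_upwards [h r hr, h' r hr] with N h h'
      exact h.copair h') f g
  inl_desc := by
    intro X Y Z f₁ f₂
    obtain ⟨F, rfl⟩ := exists_eq_ofSeq f₁
    obtain ⟨G, rfl⟩ := exists_eq_ofSeq f₂
    exact ofSeq_congr fun N => inl_desc _ _
  inr_desc := by
    intro X Y Z f₁ f₂
    obtain ⟨F, rfl⟩ := exists_eq_ofSeq f₁
    obtain ⟨G, rfl⟩ := exists_eq_ofSeq f₂
    exact ofSeq_congr fun N => inr_desc _ _
  desc_uniq := by
    intro X Y Z f₁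
    obtain ⟨F, rfl⟩ := exists_eq_ofSeq f₁
    exact ofSeq_congr fun N => desc_uniq _
  -- The canonical map is the class of the termwise canonical maps, so the termwise inverses
  -- represent an inverse.
  isIso_distrib X Y Z :=
    ⟨ofSeq (X := ⟨fun N => (X.obj N ⊞ Y.obj N) ⊗ Z.obj N⟩)
      (Y := ⟨fun N => (X.obj N ⊗ Z.obj N) ⊞ (Y.obj N ⊗ Z.obj N)⟩)
      fun N => distrib (X.obj N) (Y.obj N) (Z.obj N),
      ofSeq_congr fun N => IsIso.hom_inv_id _, ofSeq_congr fun N => IsIso.inv_hom_id _⟩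
  isIso_fromZero Z :=
    ⟨ofSeq (X := ⟨fun N => zero ⊗ Z.obj N⟩) (Y := ⟨fun N => zero⟩)
      fun N => inv (fromZero (zero ⊗ Z.obj N)),
      ofSeq_congr fun N => IsIso.hom_inv_id (fromZero (zero ⊗ Z.obj N)),
      ofSeq_congr fun N => IsIso.inv_hom_id (fromZero (zero ⊗ Z.obj N))⟩
  isDeterministic_inl X Y := ofSeq_congr fun N => isDeterministic_inl (X.obj N) (Y.obj N)
  isDeterministic_inr X Y := ofSeq_congr fun N => isDeterministic_inr (X.obj N) (Y.obj N)

end AsympStoch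
end GraphonMarkov

/-! ### Frames, and morphisms represented by functions -/

namespace GraphonMarkov
open DistributiveMarkovCategory

namespace AsympStoch
open Filter Topology

/-- An enumeration of the terms of a sequence of finite sets. -/
abbrev Frame (X : AsympStoch) (α : ℕ → Type) : Type := ∀ N, α N ≃ Fin (X.obj N).dim

variable {X X' Y Y' Z : AsympStoch} {α α' β β' γ : ℕ → Type}

/-- The frame of the monoidal unit. -/
def unitFrame : Frame (𝟙_ AsympStoch) fun _ => Unit := fun _ => Equiv.ofUnique Unit (Fin 1)

/-- The frame of a tensor product. -/
def Frame.prod (a : Frame X α) (b : Frame Y β) : Frame (X ⊗ Y) fun N => α N × β N :=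
  fun N => ((a N).prodCongr (b N)).trans pr

/-- The frame of a coproduct. -/
def Frame.sum (a : Frame X α) (b : Frame Y β) : Frame (X ⊞ Y) fun N => α N ⊕ β N :=
  fun N => ((a N).sumCongr (b N)).trans finSumFinEquiv

/-- The morphism `f` is given by the functions `φ`. -/
def RepFun (a : Frame X α) (b : Frame Y β) (f : X ⟶ Y) (φ : ∀ N, α N → β N) : Prop :=
  f = ofSeq fun N => FinStoch.ofFun fun i => b N (φ N ((a N).symm i))

theorem exists_repFun (a : Frame X α) (b : Frame Y β) (φ : ∀ N, α N → β N) :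
    ∃ f : X ⟶ Y, RepFun a b f φ := ⟨_, rfl⟩

theorem repFun_ofSeq {a : Frame X α} {b : Frame Y β} {φ : ∀ N, α N → β N}
    {F : ∀ N, Fin (X.obj N).dim → Fin (Y.obj N).dim} (h : ∀ N x, F N (a N x) = b N (φ N x)) :
    RepFun a b (ofSeq fun N => FinStoch.ofFun (F N)) φ := by
  refine ofSeq_congr fun N => congrArg _ (funext fun i => ?_)
  rw [← h, Equiv.apply_symm_apply]

/-- The device by which equations between deterministic composites are checked: represent both sides
by functions and compare these at each N and each point. -/
theorem RepFun.unique {a : Frame X α} {b : Frame Y β} {f g : X ⟶ Y} {φ ψ : ∀ N, α N → β N}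
    (hf : RepFun a b f φ) (hg : RepFun a b g ψ) (h : ∀ N x, φ N x = ψ N x) : f = g := by
  obtain rfl : φ = ψ := funext fun N => funext (h N)
  exact hf.trans hg.symm

theorem RepFun.congr {a : Frame X α} {b : Frame Y β} {f : X ⟶ Y} {φ ψ : ∀ N, α N → β N}
    (hf : RepFun a b f φ) (h : ∀ N x, φ N x = ψ N x) : RepFun a b f ψ := by
  obtain rfl : φ = ψ := funext fun N => funext (h N)
  exact hf

theorem RepFun.id (a : Frame X α) : RepFun a a (𝟙 X) fun _ x => x := by
  refine ofSeq_congr fun N => ?_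
  simp only [Equiv.apply_symm_apply]
  exact (FinStoch.ofFun_id _).symm

theorem RepFun.comp {a : Frame X α} {b : Frame Y β} {c : Frame Z γ} {f : X ⟶ Y} {g : Y ⟶ Z}
    {φ : ∀ N, α N → β N} {ψ : ∀ N, β N → γ N} (hf : RepFun a b f φ) (hg : RepFun b c g ψ) :
    RepFun a c (f ≫ g) fun N x => ψ N (φ N x) := by
  rw [RepFun] at hf hg
  rw [hf, hg]
  refine ofSeq_congr fun N => (FinStoch.ofFun_comp_ofFun _ _).trans ?_
  exact congrArg _ (funext fun i => by simp)

theorem RepFun.tensorHom {a : Frame X α} {a' : Frame X' α'} {b : Frame Y β} {b' : Frame Y' β'}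
    {f : X ⟶ X'} {g : Y ⟶ Y'} {φ : ∀ N, α N → α' N} {ψ : ∀ N, β N → β' N}
    (hf : RepFun a a' f φ) (hg : RepFun b b' g ψ) :
    RepFun (a.prod b) (a'.prod b') (f ⊗ₘ g) fun N x => (φ N x.1, ψ N x.2) := by
  rw [RepFun] at hf hg
  rw [hf, hg]
  refine ofSeq_congr fun N => (FinStoch.tensorHom_ofFun _ _).trans ?_
  exact congrArg _ (funext fun i => by simp [Frame.prod])

theorem RepFun.whiskerLeft {a : Frame X α} {b : Frame Y β} {b' : Frame Y' β'} {g : Y ⟶ Y'}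
    {ψ : ∀ N, β N → β' N} (hg : RepFun b b' g ψ) :
    RepFun (a.prod b) (a.prod b') (X ◁ g) fun N x => (x.1, ψ N x.2) := by
  rw [← id_tensorHom]
  exact (RepFun.id a).tensorHom hg

theorem RepFun.whiskerRight {a : Frame X α} {a' : Frame X' α'} {b : Frame Y β} {f : X ⟶ X'}
    {φ : ∀ N, α N → α' N} (hf : RepFun a a' f φ) :
    RepFun (a.prod b) (a'.prod b) (f ▷ Y) fun N x => (φ N x.1, x.2) := by
  rw [← tensorHom_id]
  exact hf.tensorHom (RepFun.id b)

theorem repFun_copy (a : Frame X α) : RepFun a (a.prod a) (copy X) fun _ x => (x, x) :=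
  repFun_ofSeq fun _ _ => rfl

theorem repFun_discard (a : Frame X α) : RepFun a unitFrame (discard X) fun _ _ => () :=
  repFun_ofSeq fun _ _ => rfl

theorem repFun_associator (a : Frame X α) (b : Frame Y β) (c : Frame Z γ) :
    RepFun ((a.prod b).prod c) (a.prod (b.prod c)) (α_ X Y Z).hom
      fun _ x => (x.1.1, x.1.2, x.2) :=
  repFun_ofSeq fun _ _ => FinStoch.assocEquiv_pr _ _ _

theorem repFun_braiding (a : Frame X α) (b : Frame Y β) :
    RepFun (a.prod b) (b.prod a) (β_ X Y).hom fun _ x => (x.2, x.1) :=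
  repFun_ofSeq fun _ _ => FinStoch.swapEquiv_pr _ _

theorem repFun_leftUnitor (a : Frame X α) :
    RepFun (unitFrame.prod a) a (λ_ X).hom fun _ x => x.2 :=
  repFun_ofSeq fun _ _ => FinStoch.leftUnitEquiv_pr _ _

theorem repFun_rightUnitor (a : Frame X α) :
    RepFun (a.prod unitFrame) a (ρ_ X).hom fun _ x => x.1 :=
  repFun_ofSeq fun _ _ => FinStoch.rightUnitEquiv_pr _ _

theorem repFun_inl (a : Frame X α) (b : Frame Y β) :
    RepFun a (a.sum b) (inl X Y) fun _ x => Sum.inl x :=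
  repFun_ofSeq fun _ _ => (finSumFinEquiv_apply_left _).symm

theorem repFun_inr (a : Frame X α) (b : Frame Y β) :
    RepFun b (a.sum b) (inr X Y) fun _ x => Sum.inr x :=
  repFun_ofSeq fun _ _ => (finSumFinEquiv_apply_right _).symm

/-- No block matrix is computed: the morphism represented by `Sum.elim` restricts to f and g along
the injections, so it is the copairing by uniqueness. -/
theorem RepFun.desc {a : Frame X α} {b : Frame Y β} {c : Frame Z γ} {f : X ⟶ Z} {g : Y ⟶ Z}
    {φ : ∀ N, α N → γ N} {ψ : ∀ N, β N → γ N} (hf : RepFun a c f φ) (hg : RepFun b c g ψ) :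
    RepFun (a.sum b) c (desc f g) fun N x => Sum.elim (φ N) (ψ N) x := by
  obtain ⟨h, hh⟩ := exists_repFun (a.sum b) c fun N x => Sum.elim (φ N) (ψ N) x
  have h₁ : inl X Y ≫ h = f := ((repFun_inl a b).comp hh).unique hf fun _ _ => rfl
  have h₂ : inr X Y ≫ h = g := ((repFun_inr a b).comp hh).unique hg fun _ _ => rfl
  rwa [← h₁, ← h₂, ← desc_uniq]

/-- The morphism represented by the inverse functions is a one-sided inverse of an isomorphism,
hence equal to its inverse. -/
theorem RepFun.inv {a : Frame X α} {b : Frame Y β} {e : X ≅ Y} {φ : ∀ N, α N ≃ β N}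
    (h : RepFun a b e.hom fun N => φ N) : RepFun b a e.inv fun N => (φ N).symm := by
  obtain ⟨g, hg⟩ := exists_repFun b a fun N => (φ N).symm
  have h₁ : g ≫ e.hom = 𝟙 Y := (hg.comp h).unique (RepFun.id b) fun N x => by simp
  rwa [← Category.id_comp e.inv, ← h₁, Category.assoc, Iso.hom_inv_id, Category.comp_id]

/-! ### Numeral objects -/

/-- The terms of a numeral object have their size computed by the recursion of `num`. For a variable
n it agrees with n only by induction, so the frames of numerals are casts. -/
theorem num_dim (N : ℕ) : (n : ℕ) → n = ((num AsympStoch n).obj N).dim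
  | 0 => rfl
  | 1 => rfl
  | n + 2 => congrArg (· + 1) (num_dim N (n + 1))

/-- The frame of a numeral object. -/
noncomputable def numFrame (n : ℕ) : Frame (num AsympStoch n) fun _ => Fin n :=
  fun N => finCongr (num_dim N n)

theorem repFun_pt : {n : ℕ} → (i : Fin n) →
    RepFun unitFrame (numFrame n) (pt i : 𝟙_ AsympStoch ⟶ _) fun _ _ => i
  | 0, i => i.elim0
  | 1, i => (RepFun.id unitFrame).trans (ofSeq_congr fun _ => congrArg _ (funext fun _ =>
      Subsingleton.elim (α := Fin 1) _ _))
  | n + 2, i => by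
    refine Fin.lastCases ?_ (fun j => ?_) i
    · rw [pt_last]
      refine repFun_ofSeq fun N _ => Fin.ext ?_
      -- The right injection shifts the single index 0 of the unit by the size of the left summand,
      -- whence the added 0.
      exact (congrArg (· + 0) (num_dim N (n + 1)).symm)
    · rw [pt_castSucc]
      have h : RepFun (numFrame (n + 1)) (numFrame (n + 2)) (inl (num AsympStoch (n + 1)) (𝟙_ _))
          fun _ i => i.castSucc := repFun_ofSeq fun _ _ => Fin.ext rfl
      exact (repFun_pt j).comp h

/-- A morphism out of a numeral is determined by its composites with the points `pt i`, so the
expected function need only be compared there. The same argument, on pairs of points, identifies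
`numTensor`. -/
theorem repFun_ofFun {m n : Numerals AsympStoch} (f : Fin m.val → Fin n.val) :
    RepFun (numFrame m.val) (numFrame n.val) (Numerals.ofFun f : m ⟶ n).hom fun _ => f := by
  obtain ⟨g, hg⟩ := exists_repFun (numFrame m.val) (numFrame n.val) fun _ => f
  have : (Numerals.ofFun f : m ⟶ n).hom = g := num_hom_ext fun i => by
    rw [Numerals.pt_ofFun]
    exact (repFun_pt _).unique ((repFun_pt i).comp hg) fun _ _ => rfl
  rwa [this]

theorem repFun_numTensor (m n : ℕ) : RepFun ((numFrame m).prod (numFrame n)) (numFrame (m * n))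
    (numTensor m n).hom fun _ => pr := by
  obtain ⟨g, hg⟩ := exists_repFun ((numFrame m).prod (numFrame n)) (numFrame (m * n)) fun _ => pr
  have : (numTensor m n).hom = g := tensor_num_hom_ext fun i j => by
    rw [pt_numTensor]
    exact ((repFun_leftUnitor unitFrame).comp (repFun_pt _)).unique
      (((repFun_pt i).tensorHom (repFun_pt j)).comp hg) fun _ _ => rfl
  rwa [this]

theorem repFun_numTensor_inv (m n : ℕ) :
    RepFun (numFrame (m * n)) ((numFrame m).prod (numFrame n)) (numTensor m n).inv
      fun _ => pr.symm :=
  RepFun.inv (φ := fun _ => pr) (repFun_numTensor m n)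

theorem repFun_numUnit : RepFun unitFrame (numFrame 1) (numUnit AsympStoch).hom fun _ _ => 0 :=
  repFun_pt (0 : Fin 1)

theorem repFun_numUnit_inv :
    RepFun (numFrame 1) unitFrame (numUnit AsympStoch).inv fun _ _ => () :=
  RepFun.inv (φ := fun _ => Equiv.ofUnique Unit (Fin 1)) repFun_numUnit

/-- The monoidal structure of the numerals is transported along `numTensor`. That it comes out as
the very index bijections chosen in `FinStoch` is what makes the limit functor strict. -/
theorem repFun_numerals_associator (l m n : Numerals AsympStoch) :
    RepFun (numFrame _) (numFrame _) (α_ l m n).hom.hom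
      fun _ => FinStoch.assocEquiv l.val m.val n.val := by
  rw [Numerals.associator_hom]
  refine (((repFun_numTensor_inv _ _).comp ((repFun_numTensor_inv _ _).whiskerRight.comp
    ((repFun_associator _ _ _).comp ((repFun_numTensor _ _).whiskerLeft.comp
      (repFun_numTensor _ _)))))).congr fun _ => ?_
  refine forall_pr.2 fun i k => ?_
  revert i
  refine forall_pr.2 fun i j => ?_
  simp

theorem repFun_numerals_leftUnitor (n : Numerals AsympStoch) :
    RepFun (numFrame _) (numFrame _) (λ_ n).hom.hom fun _ => FinStoch.leftUnitEquiv n.val := by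
  have h : (λ_ n).hom.hom = (numTensor 1 n.val).inv ≫ ((numUnit AsympStoch).inv ▷ num _ n.val) ≫
      (λ_ (num _ n.val)).hom := by
    refine (?_ : (((numTensor 1 n.val).symm ≪≫ ((numUnit AsympStoch).symm ⊗ᵢ .refl _)) ≪≫
      λ_ (num _ n.val)).hom = _)
    simp
  rw [h]
  refine ((repFun_numTensor_inv _ _).comp (repFun_numUnit_inv.whiskerRight.comp
    (repFun_leftUnitor _))).congr fun _ => forall_pr.2 fun i j => ?_
  simp

theorem repFun_numerals_rightUnitor (n : Numerals AsympStoch) :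
    RepFun (numFrame _) (numFrame _) (ρ_ n).hom.hom fun _ => FinStoch.rightUnitEquiv n.val := by
  have h : (ρ_ n).hom.hom = (numTensor n.val 1).inv ≫ (num _ n.val ◁ (numUnit AsympStoch).inv) ≫
      (ρ_ (num _ n.val)).hom := by
    refine (?_ : (((numTensor n.val 1).symm ≪≫ (.refl _ ⊗ᵢ (numUnit AsympStoch).symm)) ≪≫
      ρ_ (num _ n.val)).hom = _)
    simp
  rw [h]
  refine ((repFun_numTensor_inv _ _).comp (repFun_numUnit_inv.whiskerLeft.comp
    (repFun_rightUnitor _))).congr fun _ => forall_pr.2 fun i j => ?_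
  simp

theorem repFun_numerals_braiding (m n : Numerals AsympStoch) :
    RepFun (numFrame _) (numFrame _) (β_ m n).hom.hom
      fun _ => FinStoch.swapEquiv m.val n.val := by
  rw [Numerals.braiding_hom]
  refine ((repFun_numTensor_inv _ _).comp ((repFun_braiding _ _).comp
    (repFun_numTensor _ _))).congr fun _ => forall_pr.2 fun i j => ?_
  simp

theorem repFun_numerals_copy (n : Numerals AsympStoch) :
    RepFun (numFrame _) (numFrame _) (copy n).hom fun _ i => pr (i, i) :=
  (repFun_copy _).comp (repFun_numTensor _ _)

/-! ### Limits of matrix entries -/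

section Lim

variable {A B D A' B' : Type}

/-- The limit of the entries of a sequence of stochastic matrices. -/
noncomputable def limMat (a : Frame X fun _ => A) (b : Frame Y fun _ => B) (f : X ⟶ Y) :
    Matrix A B ℝ :=
  fun x y => limUnder ultra fun N => ((exists_eq_ofSeq f).choose N).mat (a N x) (b N y)

theorem mat_le_one {m n : FinStoch} (f : m ⟶ n) (i j) : f.mat i j ≤ 1 := by
  rw [← f.row_sum i]
  exact Finset.single_le_sum (fun k _ => f.nonneg i k) (Finset.mem_univ j)

/-- Compactness of [0,1]: an ultrafilter on it converges. This is why limits are taken along an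
ultrafilter, since an arbitrary sequence of matrices need not converge in the ordinary sense. -/
theorem exists_tendsto_ultra {u : ℕ → ℝ} (h : ∀ N, u N ∈ Set.Icc (0 : ℝ) 1) :
    ∃ c, Tendsto u ultra (𝓝 c) := by
  obtain ⟨c, -, hc⟩ := isCompact_Icc.ultrafilter_le_nhds (ultra.map u)
    (le_principal_iff.2 (Eventually.of_forall (f := (ultra : Filter ℕ)) h))
  exact ⟨c, hc⟩

/-- `limMat` uses a chosen representative, but any other one has the same limit: the entries differ
by at most the ℓ¹-distance of the rows, which tends to 0. -/
theorem tendsto_limMat (a : Frame X fun _ => A) (b : Frame Y fun _ => B)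
    (F : ∀ N, X.obj N ⟶ Y.obj N) (x : A) (y : B) :
    Tendsto (fun N => (F N).mat (a N x) (b N y)) ultra (𝓝 (limMat a b (ofSeq F) x y)) := by
  have h := ofSeq_eq_iff.1 (exists_eq_ofSeq (ofSeq F)).choose_spec
  set G := (exists_eq_ofSeq (ofSeq F)).choose
  have hG : Tendsto (fun N => (G N).mat (a N x) (b N y)) ultra (𝓝 (limMat a b (ofSeq F) x y)) :=
    tendsto_nhds_limUnder (exists_tendsto_ultra fun N =>
      ⟨(G N).nonneg _ _, mat_le_one _ _ _⟩)
  have hd : Tendsto (fun N => (F N).mat (a N x) (b N y) - (G N).mat (a N x) (b N y)) ultra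
      (𝓝 0) := by
    rw [Metric.tendsto_nhds]
    intro r hr
    filter_upwards [h (r / 2) (half_pos hr)] with N hN
    rw [Real.dist_0_eq_abs]
    refine lt_of_le_of_lt ((Finset.single_le_sum (fun k _ => abs_nonneg _)
      (Finset.mem_univ (b N y))).trans (hN (a N x))) (half_lt_self hr)
  simpa using hd.add hG

theorem limMat_eq_of_tendsto {a : Frame X fun _ => A} {b : Frame Y fun _ => B}
    {F : ∀ N, X.obj N ⟶ Y.obj N} {x : A} {y : B} {c : ℝ}
    (h : Tendsto (fun N => (F N).mat (a N x) (b N y)) ultra (𝓝 c)) :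
    limMat a b (ofSeq F) x y = c :=
  tendsto_nhds_unique (tendsto_limMat a b F x y) h

theorem limMat_nonneg (a : Frame X fun _ => A) (b : Frame Y fun _ => B) (f : X ⟶ Y) (x : A)
    (y : B) : 0 ≤ limMat a b f x y := by
  obtain ⟨F, rfl⟩ := exists_eq_ofSeq f
  exact ge_of_tendsto' (tendsto_limMat a b F x y) fun N => (F N).nonneg _ _

/-- The index set B does not vary with N, so the limit passes through the finite sum and no mass
escapes. The same interchange gives multiplicativity in `limMat_comp`. -/
theorem sum_limMat [Fintype B] (a : Frame X fun _ => A) (b : Frame Y fun _ => B) (f : X ⟶ Y)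
    (x : A) : ∑ y, limMat a b f x y = 1 := by
  obtain ⟨F, rfl⟩ := exists_eq_ofSeq f
  refine tendsto_nhds_unique (tendsto_finsetSum _ fun y _ => tendsto_limMat a b F x y) ?_
  refine Tendsto.congr (fun N => ?_) tendsto_const_nhds
  rw [(b N).sum_comp fun j => (F N).mat (a N x) j, (F N).row_sum]

theorem limMat_comp [Fintype B] (a : Frame X fun _ => A) (b : Frame Y fun _ => B)
    (c : Frame Z fun _ => D) (f : X ⟶ Y) (g : Y ⟶ Z) :
    limMat a c (f ≫ g) = limMat a b f * limMat b c g := by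
  obtain ⟨F, rfl⟩ := exists_eq_ofSeq f
  obtain ⟨G, rfl⟩ := exists_eq_ofSeq g
  ext x z
  rw [ofSeq_comp, Matrix.mul_apply]
  refine limMat_eq_of_tendsto (Tendsto.congr (fun N => ?_) (tendsto_finsetSum _ fun y _ =>
    (tendsto_limMat a b F x y).mul (tendsto_limMat b c G y z)))
  rw [FinStoch.comp_apply]
  exact (b N).sum_comp fun j => (F N).mat (a N x) j * (G N).mat j (c N z)

theorem limMat_tensorHom (a : Frame X fun _ => A) (a' : Frame X' fun _ => A')
    (b : Frame Y fun _ => B) (b' : Frame Y' fun _ => B') (f : X ⟶ X') (g : Y ⟶ Y') (x : A) (x' : A')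
    (y : B) (y' : B') : limMat (A := A × B) (B := A' × B') (a.prod b)
      (a'.prod b') (f ⊗ₘ g) ((x, y) : A × B)
      ((x', y') : A' × B') = limMat a a' f x x' * limMat b b' g y y' := by
  obtain ⟨F, rfl⟩ := exists_eq_ofSeq f
  obtain ⟨G, rfl⟩ := exists_eq_ofSeq g
  have h := (tendsto_limMat a a' F x x').mul (tendsto_limMat b b' G y y')
  refine limMat_eq_of_tendsto (A := A × B) (B := A' × B') (a := a.prod b) (b := a'.prod b')
    (F := fun N => F N ⊗ₘ G N) (x := (x, y)) (y := (x', y')) (h.congr fun N => ?_)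
  exact (FinStoch.tensorHom_apply (F N) (G N) _ _ _ _).symm

theorem RepFun.limMat [DecidableEq B] {a : Frame X fun _ => A} {b : Frame Y fun _ => B} {f : X ⟶ Y}
    {φ : A → B} (h : RepFun a b f fun _ => φ) (x : A) (y : B) :
    limMat a b f x y = if φ x = y then 1 else 0 := by
  rw [RepFun] at h
  rw [h]
  refine limMat_eq_of_tendsto (Tendsto.congr (fun N => ?_) tendsto_const_nhds)
  rw [FinStoch.ofFun_apply, Equiv.symm_apply_apply]
  simp

/-- Faithfulness of the Bernoulli base. With fixed finite index sets, entrywise convergence to 0 of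
the difference is the same as convergence of the largest ℓ¹-distance of rows, which is the relation
defining the morphisms. -/
theorem limMat_injective [Finite A] [Fintype B] (a : Frame X fun _ => A) (b : Frame Y fun _ => B) :
    Function.Injective (limMat a b : (X ⟶ Y) → Matrix A B ℝ) := by
  intro f g h
  obtain ⟨F, rfl⟩ := exists_eq_ofSeq f
  obtain ⟨G, rfl⟩ := exists_eq_ofSeq g
  refine ofSeq_eq_iff.2 fun r hr => ?_
  have key (x : A) : ∀ᶠ N in ultra,
      ∑ y, |(F N).mat (a N x) (b N y) - (G N).mat (a N x) (b N y)| ≤ r := by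
    have ht := tendsto_finsetSum Finset.univ fun y (_ : y ∈ Finset.univ) =>
      ((tendsto_limMat a b F x y).sub (tendsto_limMat a b G x y)).abs
    simp only [h, sub_self, abs_zero, Finset.sum_const_zero] at ht
    exact (ht.eventually (gt_mem_nhds hr)).mono fun _ h => h.le
  -- Finiteness of A makes the bound uniform over the rows.
  filter_upwards [eventually_all.2 key] with N hN i
  have := hN ((a N).symm i)
  rw [Equiv.apply_symm_apply] at this
  rwa [(b N).sum_comp fun j => |(F N).mat i j - (G N).mat i j|] at this

end Lim

/-! ### The Bernoulli base -/

/-- The functor taking a morphism of numerals to the limit of its matrices. -/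
noncomputable def limFunctor : Numerals AsympStoch ⥤ FinStoch where
  obj n := ⟨n.val⟩
  map {m n} f := FinStoch.Hom.mk (limMat (numFrame m.val) (numFrame n.val) f.hom)
    (limMat_nonneg _ _ _) (sum_limMat _ _ _)
  map_id n := FinStoch.hom_ext fun i j => (RepFun.limMat (RepFun.id (numFrame n.val)) i j).trans
    (Matrix.one_apply).symm
  map_comp f g := FinStoch.hom_ext fun i j =>
    congrFun₂ (limMat_comp _ (numFrame _) _ f.hom g.hom) i j

theorem limFunctor_map {m n : Numerals AsympStoch} {f : m ⟶ n} {φ : Fin m.val → Fin n.val}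
    (h : RepFun (numFrame m.val) (numFrame n.val) f.hom fun _ => φ) :
    limFunctor.map f = FinStoch.ofFun (m := ⟨m.val⟩) (n := ⟨n.val⟩) φ :=
  FinStoch.hom_ext fun i j => h.limMat i j

/-- The Bernoulli base of `AsympStoch` given by limits of matrices. -/
noncomputable def bernoulliBase : BernoulliBase AsympStoch where
  toFunctor := limFunctor
  obj_unit := rfl
  obj_tensor _ _ := rfl
  map_tensor {m m' n n'} f g := heq_of_eq <| by
    refine FinStoch.hom_ext (m := ⟨m.val * n.val⟩) (n := ⟨m'.val * n'.val⟩) (forall_pr.2 fun i k =>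
      forall_pr.2 fun j l => ?_)
    refine Eq.trans ?_ (FinStoch.tensorHom_apply (limFunctor.map f) (limFunctor.map g) i j k l).symm
    refine Eq.trans ?_ (limMat_tensorHom (numFrame m.val) (numFrame m'.val) (numFrame n.val)
      (numFrame n'.val) f.hom g.hom i j k l)
    -- The tensor of morphisms of numerals is conjugated by `numTensor`, whose limit matrices are
    -- the 0/1 matrices of `pr` and its inverse. Multiplying by them leaves a single term of each
    -- sum.
    have h₁ := (repFun_numTensor_inv m.val n.val).limMat
    have h₂ := (repFun_numTensor m'.val n'.val).limMat
    refine (congrFun₂ (limMat_comp _ ((numFrame m.val).prod (numFrame n.val)) _ _ _) _ _).trans ?_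
    rw [limMat_comp _ ((numFrame m'.val).prod (numFrame n'.val)), Matrix.mul_apply]
    refine (Finset.sum_congr rfl fun _ _ => congrArg₂ _ (h₁ _ _) (Matrix.mul_apply.trans
      (Finset.sum_congr rfl fun _ _ => congrArg₂ _ rfl (h₂ _ _)))).trans ?_
    simp
  map_associator l m n := heq_of_eq (limFunctor_map (repFun_numerals_associator l m n))
  map_leftUnitor n := heq_of_eq (limFunctor_map (repFun_numerals_leftUnitor n))
  map_rightUnitor n := heq_of_eq (limFunctor_map (repFun_numerals_rightUnitor n))
  map_braiding m n := heq_of_eq (limFunctor_map (repFun_numerals_braiding m n))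
  map_copy n := heq_of_eq (limFunctor_map (repFun_numerals_copy n))
  map_discard _ := heq_of_eq (FinStoch.eq_to_unit _ _)
  obj_zero := rfl
  obj_coprod _ _ := rfl
  map_inl m n :=
    heq_of_eq (limFunctor_map (repFun_ofFun (n := ⟨m.val + n.val⟩) (Fin.castAdd n.val)))
  map_inr m n :=
    heq_of_eq (limFunctor_map (repFun_ofFun (n := ⟨m.val + n.val⟩) (Fin.natAdd m.val)))
  faithful {m n} f g h := Numerals.hom_ext <| limMat_injective (numFrame m.val) (numFrame n.val) <|
    congrArg FinStoch.Hom.mat h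

theorem bernoulliBase_matrix {m n : ℕ} (f : num AsympStoch m ⟶ num AsympStoch n) :
    bernoulliBase.matrix f = limMat (numFrame m) (numFrame n) f := by
  unfold BernoulliBase.matrix
  -- The functor preserves numerals by definition, so the transports in `matrix` are identities.
  have h₁ : eqToHom (bernoulliBase.obj_mk m).symm = 𝟙 (⟨m⟩ : FinStoch) := rfl
  have h₂ : eqToHom (bernoulliBase.obj_mk n) = 𝟙 (⟨n⟩ : FinStoch) := rfl
  refine (congrArg FinStoch.Hom.mat (?_ : _ = limFunctor.map (X := ⟨m⟩) (Y := ⟨n⟩) ⟨f⟩)).trans rfl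
  rw [h₁, h₂]
  exact (Category.id_comp _).trans (Category.comp_id _)

end AsympStoch
end GraphonMarkov

namespace GraphonMarkov
open DistributiveMarkovCategory

/-! ### Values of numeral types -/

namespace Ty

variable {K : Type}

/-- Together with injectivity of `boolVal` and `tupleVal`, this turns an equality of matrix indices
into an equality of boolean adjacency matrices. -/
theorem index_injective : (A : Ty K) → Function.Injective A.index
  | .const _ => fun x => x.elim
  | .unit => fun _ _ _ => rfl
  | .zero => fun x => x.elim
  | .prod A B => fun x y h => by
    obtain ⟨h₁, h₂⟩ := Prod.mk.inj (pr.injective h)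
    exact Prod.ext (A.index_injective h₁) (B.index_injective h₂)
  | .sum A B => by
    rintro (x | x) (y | y) h
    · exact congrArg _ (A.index_injective (Fin.castAdd_injective _ _ h))
    · exact absurd (congrArg Fin.val h) (by
        have := (A.index x).isLt
        change (A.index x : ℕ) ≠ A.size + B.index y
        omega)
    · exact absurd (congrArg Fin.val h) (by
        have := (A.index y).isLt
        change A.size + (B.index x : ℕ) ≠ A.index y
        omega)
    · exact congrArg _ (B.index_injective (Fin.natAdd_injective _ _ h))

theorem boolVal_injective : Function.Injective (boolVal : Bool → (bool : Ty K).Val) := by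
  rintro (_ | _) (_ | _) h
  exacts [rfl, (Sum.inr_ne_inl h).elim, (Sum.inl_ne_inr h).elim, rfl]

theorem tupleVal_injective {A : Ty K} :
    {n : ℕ} → Function.Injective (tupleVal : (Fin n → A.Val) → (A.pow n).Val)
  | 0, _, _, _ => Subsingleton.elim _ _
  | n + 1, v, w, h => by
    obtain ⟨h₁, h₂⟩ := Prod.mk.inj h
    funext i
    exact Fin.cases h₁ (fun i => congrFun (tupleVal_injective h₂) i) i

/-- The frame of a numeral type. -/
noncomputable def frame (obj : K → AsympStoch) :
    (A : Ty K) → A.IsNumeral → AsympStoch.Frame (A.interp obj) fun _ => A.Val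
  | .const _ => fun h => h.elim
  | .unit => fun _ => AsympStoch.unitFrame
  | .zero => fun _ _ => Equiv.equivOfIsEmpty Empty (Fin 0)
  | .prod A B => fun h => (A.frame obj h.1).prod (B.frame obj h.2)
  | .sum A B => fun h => (A.frame obj h.1).sum (B.frame obj h.2)

theorem repFun_toNum (obj : K → AsympStoch) : (A : Ty K) → (h : A.IsNumeral) →
    AsympStoch.RepFun (A.frame obj h) (AsympStoch.numFrame A.size) (A.toNum obj h) fun _ => A.index
  | .const _ => fun h => h.elim
  | .unit => fun _ => AsympStoch.repFun_numUnit
  | .zero => fun _ => zero_hom_ext _ _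
  | .prod A B => fun h =>
    ((repFun_toNum obj A h.1).tensorHom (repFun_toNum obj B h.2)).comp
      (AsympStoch.repFun_numTensor _ _)
  | .sum A B => fun h =>
    (((repFun_toNum obj A h.1).comp (AsympStoch.repFun_ofFun (m := ⟨A.size⟩)
      (n := ⟨A.size + B.size⟩) (Fin.castAdd B.size))).desc
    ((repFun_toNum obj B h.2).comp (AsympStoch.repFun_ofFun (m := ⟨B.size⟩)
      (n := ⟨A.size + B.size⟩) (Fin.natAdd A.size)))).congr fun _ x => by cases x <;> rfl

end Ty

theorem matrixVal_injective {n : ℕ} :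
    Function.Injective (matrixVal : (Fin n → Fin n → Bool) → _) := fun a b h => by
  have := Ty.tupleVal_injective h
  funext i j
  exact Ty.boolVal_injective (congrFun (Ty.tupleVal_injective (congrFun this i)) j)

/-! ### The interpretation given by a sequence of finite graphs -/

/-- A nonempty finite simple graph on an initial segment of the natural numbers. -/
structure FinGraph where
  order : ℕ
  order_pos : 0 < order
  adj : Fin order → Fin order → Bool
  irrefl (x : Fin order) : adj x x = false
  symm (x y : Fin order) : adj x y = adj y x

/-- The uniform distribution on the vertices of a finite graph. -/
noncomputable def FinGraph.uniform (G : FinGraph) : 𝟙_ FinStoch ⟶ (⟨G.order⟩ : FinStoch) :=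
  FinStoch.Hom.mk (fun _ _ => 1 / (G.order : ℝ)) (fun _ _ => by positivity) fun _ => by
    have : (G.order : ℝ) ≠ 0 := Nat.cast_ne_zero.2 G.order_pos.ne'
    exact (Fin.sum_const G.order _).trans (by simp [this])

/-- The probability that uniformly random vertices have the adjacency matrix `a`. -/
noncomputable def FinGraph.density (G : FinGraph) {n : ℕ} (a : Fin n → Fin n → Bool) : ℝ :=
  ∑ x : Fin n → Fin G.order, if (fun i j => G.adj (x i) (x j)) = a then (1 / G.order : ℝ) ^ n else 0

namespace AsympStoch
open Filter Topology

variable (G : ℕ → FinGraph)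

/-- The sequence of vertex sets. -/
def vertexObj : AsympStoch := ⟨fun N => ⟨(G N).order⟩⟩

/-- Uniformly random vertices. -/
noncomputable def newHom : 𝟙_ AsympStoch ⟶ vertexObj G :=
  ofSeq (X := ⟨fun _ => 𝟙_ FinStoch⟩) fun N => (G N).uniform

/-- The frame of the object of vertices. -/
def vertexFrame : Frame (vertexObj G) fun N => Fin (G N).order := fun _ => Equiv.refl _

/-- Adjacency of vertices. -/
noncomputable def edgeHom : vertexObj G ⊗ vertexObj G ⟶ 𝟙_ AsympStoch ⊞ 𝟙_ AsympStoch :=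
  (exists_repFun ((vertexFrame G).prod (vertexFrame G)) (unitFrame.sum unitFrame) fun N x =>
    (Ty.boolVal ((G N).adj x.1 x.2) : (Ty.bool : Ty Unit).Val)).choose

theorem repFun_edgeHom : RepFun ((vertexFrame G).prod (vertexFrame G)) (unitFrame.sum unitFrame)
    (edgeHom G) fun N x => (Ty.boolVal ((G N).adj x.1 x.2) : (Ty.bool : Ty Unit).Val) :=
  (exists_repFun ((vertexFrame G).prod (vertexFrame G)) (unitFrame.sum unitFrame) fun N x =>
    (Ty.boolVal ((G N).adj x.1 x.2) : (Ty.bool : Ty Unit).Val)).choose_spec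

/-- The interpretation of the graph interface given by a sequence of finite graphs. -/
noncomputable def graphInterp : Interp AsympStoch graphInterface where
  obj _ := vertexObj G
  hom
    | .new => newHom G
    | .edge => edgeHom G

variable {G} {Γ : List (Ty Unit)} {α : ℕ → Type} {c : Frame (ctxInterp (graphInterp G).obj Γ) α}

theorem repFun_edgeTm {t u : Tm graphInterface Γ vertex} {φ ψ : ∀ N, α N → Fin (G N).order}
    (ht : RepFun c (vertexFrame G) ((graphInterp G).term t) φ)
    (hu : RepFun c (vertexFrame G) ((graphInterp G).term u) ψ) :
    RepFun c (Ty.bool.frame (graphInterp G).obj ⟨trivial, trivial⟩)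
      ((graphInterp G).term (edgeTm t u))
      fun N x => Ty.boolVal ((G N).adj (φ N x) (ψ N x)) :=
  ((repFun_copy c).comp (ht.tensorHom hu)).comp (repFun_edgeHom G)

theorem repFun_tuple {A : Ty Unit} (h : A.IsNumeral) :
    {n : ℕ} → {t : Fin n → Tm graphInterface Γ A} →
    {φ : Fin n → ∀ N, α N → A.Val} →
    (∀ i, RepFun c (A.frame (graphInterp G).obj h) ((graphInterp G).term (t i)) (φ i)) →
    RepFun c ((A.pow n).frame (graphInterp G).obj (Ty.isNumeral_pow h n))
      ((graphInterp G).term (Tm.tuple n t)) fun N x => Ty.tupleVal fun i => φ i N x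
  | 0, _, _, _ => repFun_discard c
  | _ + 1, _, _, ht => (repFun_copy c).comp ((ht 0).tensorHom (repFun_tuple h fun i => ht i.succ))

theorem repFun_var_last {α : ℕ → Type} (c : Frame (ctxInterp (graphInterp G).obj Γ) α) :
    RepFun (Y := vertexObj G) (c.prod (vertexFrame G)) (vertexFrame G)
      ((.last : Var (vertex :: Γ) vertex).interp (graphInterp G).obj) fun _ x => x.2 :=
  (repFun_discard c).whiskerRight.comp (repFun_leftUnitor _)

theorem repFun_var_weaken {α : ℕ → Type} {c : Frame (ctxInterp (graphInterp G).obj Γ) α}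
    {v : Var Γ vertex} {φ : ∀ N, α N → Fin (G N).order}
    (h : RepFun (Y := vertexObj G) c (vertexFrame G) (v.interp (graphInterp G).obj) φ) :
    RepFun (Y := vertexObj G) (c.prod (vertexFrame G)) (vertexFrame G)
      ((.weaken v : Var (vertex :: Γ) vertex).interp (graphInterp G).obj) fun N x => φ N x.1 :=
  (repFun_discard (vertexFrame G)).whiskerLeft.comp ((repFun_rightUnitor c).comp h)

-- No limit is involved: all three conditions are equalities of functions, valid in every single
-- graph of the sequence. Determinism holds because `edge` is represented by functions.
variable (G) in
theorem isGraphTheory_graphInterp : IsGraphTheory (graphInterp G) where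
  irrefl := by
    have hv := repFun_var_last (G := G) (Γ := []) unitFrame
    exact (repFun_edgeTm hv hv).unique ((repFun_discard _).comp (repFun_inr unitFrame unitFrame))
      fun N x => congrArg Ty.boolVal ((G N).irrefl _)
  symm := by
    have hv := repFun_var_last (G := G) (Γ := []) unitFrame
    have hw := repFun_var_last (G := G) (Γ := [vertex]) (unitFrame.prod (vertexFrame G))
    exact (repFun_edgeTm (repFun_var_weaken hv) hw).unique (repFun_edgeTm hw (repFun_var_weaken hv))
      fun N x => congrArg Ty.boolVal ((G N).symm _ _)
  deterministic :=
    ((repFun_edgeHom G).comp (repFun_copy _)).unique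
      ((repFun_copy _).comp ((repFun_edgeHom G).tensorHom (repFun_edgeHom G))) fun _ _ => rfl

/-! ### Contexts of vertices and the distribution of the graph program -/

/-- Splitting off the last entry of a tuple. -/
def initLastEquiv (n : ℕ) (A : Type) : (Fin (n + 1) → A) ≃ (Fin n → A) × A where
  toFun x := (Fin.init x, x (Fin.last n))
  invFun x := Fin.snoc x.1 x.2
  left_inv x := Fin.snoc_init_self x
  right_inv x := by simp

variable (G) in
/-- The frame of a context of vertices. -/
noncomputable def ctxFrame : (n : ℕ) →
    Frame (ctxInterp (graphInterp G).obj (List.replicate n vertex)) fun N => Fin n → Fin (G N).order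
  | 0 => fun _ => Equiv.ofUnique _ (Fin 1)
  | n + 1 => fun N => (initLastEquiv n _).trans (((ctxFrame n).prod (vertexFrame G)) N)

/-- Change of frame on one object. It mediates between n + 1 vertices as a tuple and as a pair of a
shorter tuple and a last vertex. -/
theorem repFun_id_of_eq {X : AsympStoch} {α β : ℕ → Type} {a : Frame X α} {b : Frame X β}
    {φ : ∀ N, α N → β N} (h : ∀ N x, a N x = b N (φ N x)) : RepFun a b (𝟙 X) φ := by
  refine (?_ : _ = ofSeq fun N => FinStoch.ofFun id).trans (repFun_ofSeq h)
  exact ofSeq_congr fun N => (FinStoch.ofFun_id _).symm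

theorem repFun_nthVertex : {n : ℕ} → (i : Fin n) →
    RepFun (Y := vertexObj G) (ctxFrame G n) (vertexFrame G)
      ((nthVertex i).interp (graphInterp G).obj) fun _ x => x i
  | 0, i => i.elim0
  | n + 1, i => by
    have hs : RepFun (ctxFrame G (n + 1)) ((ctxFrame G n).prod (vertexFrame G)) (𝟙 _)
        fun N => initLastEquiv n _ := repFun_id_of_eq fun _ _ => rfl
    refine Fin.lastCases ?_ (fun j => ?_) i
    · have := hs.comp (repFun_var_last (ctxFrame G n))
      rw [nthVertex, Fin.lastCases_last]
      exact (Category.id_comp _).symm.trans this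
    · have := hs.comp (repFun_var_weaken (repFun_nthVertex j))
      rw [nthVertex, Fin.lastCases_castSucc]
      exact (Category.id_comp _).symm.trans this

variable (G) in
/-- The state of `n` independent uniformly random vertices. -/
noncomputable def newCtx :
    (n : ℕ) → (𝟙_ AsympStoch ⟶ ctxInterp (graphInterp G).obj (List.replicate n vertex))
  | 0 => 𝟙 _
  | n + 1 => (ρ_ _).inv ≫ (newCtx n ⊗ₘ newHom G)

/-- Binding copies the context in order to evaluate `new()`, which discards its copy. By counitality
the two cancel, leaving the context tensored with a fresh independent vertex. -/
theorem newCtx_comp_letIn (n : ℕ) {A : Ty Unit}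
    (t : Tm graphInterface (List.replicate (n + 1) vertex) A) :
    newCtx G n ≫ (graphInterp G).term (.letIn newTm t) =
      newCtx G (n + 1) ≫ (graphInterp G).term t := by
  have h : newCtx G n ≫ copy _ ≫ (_ ◁ (discard _ ≫ newHom G)) = newCtx G (n + 1) := by
    rw [MonoidalCategory.whiskerLeft_comp, ← Category.assoc (copy _)]
    refine (congrArg (fun f => _ ≫ f ≫ _) (ComonObj.comul_counit _)).trans ?_
    rw [rightUnitor_inv_naturality_assoc, ← MonoidalCategory.tensorHom_def]
    rfl
  have key {X : AsympStoch} (q : _ ⊗ vertexObj G ⟶ X) :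
      newCtx G n ≫ copy _ ≫ (_ ◁ (discard _ ≫ newHom G)) ≫ q =
        (newCtx G n ≫ copy _ ≫ (_ ◁ (discard _ ≫ newHom G))) ≫ q := by
    simp only [Category.assoc]
  exact (key _).trans (congrArg (· ≫ (graphInterp G).term t) h)

theorem term_letNew : (n : ℕ) → {A : Ty Unit} →
    (t : Tm graphInterface (List.replicate n vertex) A) →
    (graphInterp G).term (letNew n t) = newCtx G n ≫ (graphInterp G).term t
  | 0, _, t => (Category.id_comp ((graphInterp G).term t)).symm
  | n + 1, _, t => (term_letNew n (.letIn newTm t)).trans (newCtx_comp_letIn n t)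

/-- A morphism is only a class, so a representative is exhibited for which the uniform distribution
on n-tuples of vertices is exact at every N. -/
theorem exists_newCtx_eq_ofSeq : (n : ℕ) → ∃ F, newCtx G n = ofSeq F ∧
    ∀ N x, (F N).mat (0 : Fin 1) (ctxFrame G n N x) = (1 / (G N).order : ℝ) ^ n
  | 0 => ⟨_, rfl, fun N x => (Matrix.one_apply (n := Fin 1)).trans
      ((if_pos (Subsingleton.elim _ _)).trans (pow_zero _).symm)⟩
  | n + 1 => by
    obtain ⟨F, hF, h⟩ := exists_newCtx_eq_ofSeq n
    refine ⟨_, congrArg (fun f => (ρ_ _).inv ≫ (f ⊗ₘ newHom G)) hF, fun N x => ?_⟩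
    refine (FinStoch.ofFun_comp_apply _ _ _ _).trans ?_
    refine (congrArg (fun i => (F N ⊗ₘ (G N).uniform).mat i (ctxFrame G (n + 1) N x))
      (FinStoch.rightUnitEquiv_symm (0 : Fin 1))).trans ?_
    refine (FinStoch.tensorHom_apply _ _ _ _ _ _).trans ?_
    rw [pow_succ]
    exact congrArg (· * _) (h N _)

/-- For each N, pushing the uniform distribution on n-tuples forward along the adjacency matrix
gives the density of the N-th graph. The Bernoulli base then takes the limit of these numbers. -/
theorem prob_graphProgram {n : ℕ} {a : Fin n → Fin n → Bool} {p : ℝ}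
    (h : Tendsto (fun N => (G N).density a) ultra (𝓝 p)) :
    bernoulliBase.prob (graphInterp G) (isNumeral_matrix n) (graphProgram n) (matrixVal a) = p := by
  rw [BernoulliBase.prob, bernoulliBase_matrix, graphProgram, term_letNew]
  have hb : (Ty.bool : Ty Unit).IsNumeral := ⟨trivial, trivial⟩
  have ht : RepFun (ctxFrame G n) _ _ _ := (repFun_tuple (Ty.isNumeral_pow hb n) fun i =>
    repFun_tuple hb fun j => repFun_edgeTm (t := .var (nthVertex i)) (u := .var (nthVertex j))
      (repFun_nthVertex (G := G) i) (repFun_nthVertex j)).comp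
      (Ty.repFun_toNum _ _ (isNumeral_matrix n))
  rw [RepFun] at ht
  obtain ⟨F, hF, hF'⟩ := exists_newCtx_eq_ofSeq (G := G) n
  have hf : (numUnit AsympStoch).inv ≫ (newCtx G n ≫ (graphInterp G).term (Tm.tuple n fun i =>
      Tm.tuple n fun j => edgeTm (.var (nthVertex i)) (.var (nthVertex j)))) ≫
      Ty.toNum (graphInterp G).obj _ (isNumeral_matrix n) = _ :=
    (Category.id_comp _).trans ((Category.assoc _ _ _).trans (congrArg₂ _ hF ht))
  refine (congrFun₂ (congrArg (limMat (numFrame 1) (numFrame _)) hf) _ _).trans ?_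
  refine limMat_eq_of_tendsto (h.congr fun N => ?_)
  refine Eq.trans ?_ (FinStoch.comp_apply _ _ _ _).symm
  refine Eq.trans ?_ ((ctxFrame G n N).sum_comp _)
  refine Finset.sum_congr rfl fun x _ => ?_
  rw [FinStoch.ofFun_apply, Equiv.symm_apply_apply]
  refine Eq.trans ?_ (congrArg (· * _) (hF' N x).symm)
  rw [mul_ite, mul_one, mul_zero]
  exact if_congr ((numFrame _ N).injective.eq_iff.trans
    ((Ty.index_injective _).eq_iff.trans matrixVal_injective.eq_iff)).symm rfl rfl

end AsympStoch
end GraphonMarkov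

/-! ### Sampling from a graphon: labels, coins and independence -/

namespace GraphonMarkov
open MeasureTheory ProbabilityTheory

/-- Restricting along an injection preserves product measures. -/
theorem measurePreserving_comp_of_injective {ι κ X : Type*} [Fintype ι] [Fintype κ]
    [MeasureSpace X] [IsProbabilityMeasure (volume : Measure X)] {e : κ → ι}
    (he : Function.Injective e) :
    MeasurePreserving (fun (z : ι → X) k => z (e k)) volume volume := by
  refine ⟨by fun_prop, ?_⟩
  have h : iIndepFun (fun (i : ι) (z : ι → X) => z i) (volume : Measure (ι → X)) :=
    iIndepFun_pi (μ := fun _ => volume) (X := fun _ x => x) fun _ => aemeasurable_id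
  rw [(iIndepFun_iff_map_fun_eq_pi_map fun k => (measurable_pi_apply (e k)).aemeasurable).1
    (h.precomp he)]
  exact congrArg Measure.pi (funext fun k =>
    (measurePreserving_eval (fun _ => volume) (e k)).map_eq)

/-- The birthday estimate. With k = |κ| ≤ M, at least (M − k)^k maps are injective, and Bernoulli's
inequality bounds this below by (1 − k²/M)·M^k. -/
theorem card_not_injective_le (κ : Type*) [Fintype κ] [DecidableEq κ] {M : ℕ} (hM : 0 < M) :
    ((Finset.univ.filter fun f : κ → Fin M => ¬ Function.Injective f).card : ℝ) ≤
      (Fintype.card κ : ℝ) ^ 2 / M * (M : ℝ) ^ Fintype.card κ := by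
  set k := Fintype.card κ
  have hM' : (0 : ℝ) < M := Nat.cast_pos.2 hM
  have hcard : (Finset.univ.filter fun f : κ → Fin M => Function.Injective f).card =
      M.descFactorial k := by
    rw [← Fintype.card_subtype, Fintype.card_congr (Equiv.subtypeInjectiveEquivEmbedding κ (Fin M)),
      Fintype.card_embedding_eq, Fintype.card_fin]
  have hsum := Finset.card_filter_add_card_filter_not (s := Finset.univ)
    fun f : κ → Fin M => Function.Injective f
  rw [hcard, Finset.card_univ, Fintype.card_fun, Fintype.card_fin] at hsum
  have hsum' : (M.descFactorial k : ℝ) +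
      (Finset.univ.filter fun f : κ → Fin M => ¬ Function.Injective f).card = (M : ℝ) ^ k := by
    exact_mod_cast hsum
  have hpos : (0 : ℝ) ≤ M.descFactorial k := Nat.cast_nonneg _
  rcases le_or_gt k M with hk | hk
  · have h₁ : ((M - k : ℝ)) ^ k ≤ M.descFactorial k := by
      refine le_trans ?_ (Nat.cast_le.2 (Nat.pow_sub_le_descFactorial M k))
      rw [Nat.cast_pow]
      refine pow_le_pow_left₀ (sub_nonneg.2 (Nat.cast_le.2 hk)) ?_ k
      rw [← Nat.cast_sub hk]
      exact Nat.cast_le.2 (by omega)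
    have h₂ : 1 + (k : ℝ) * (-(k / M)) ≤ (1 + -(k / M : ℝ)) ^ k := by
      refine one_add_mul_le_pow ?_ k
      have : (k / M : ℝ) ≤ 1 := (div_le_one hM').2 (Nat.cast_le.2 hk)
      linarith
    have h₃ : (M - k : ℝ) = (1 + -(k / M : ℝ)) * M := by field_simp; ring
    rw [h₃, mul_pow] at h₁
    have h₄ := mul_le_mul_of_nonneg_right h₂ (pow_nonneg hM'.le k)
    have h₅ : (1 + (k : ℝ) * (-(k / M))) * (M : ℝ) ^ k = (M : ℝ) ^ k - k ^ 2 / M * M ^ k := by ring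
    linarith
  -- For k > M the claimed bound is at least the number of all maps.
  · have h₁ : (1 : ℝ) ≤ k ^ 2 / M := by
      rw [le_div_iff₀ hM', one_mul]
      exact_mod_cast hk.le.trans (Nat.le_self_pow two_ne_zero k)
    have := mul_le_mul_of_nonneg_right h₁ (pow_nonneg hM'.le k)
    linarith

namespace Graphon

variable (W : Graphon)

/-- The adjacency matrix sampled from a graphon, given labels of the vertices and coins for pairs of
vertices. -/
noncomputable def sample {T : Type*} [DecidableEq T] (z : T ⊕ Sym2 T → unitInterval) (i j : T) :
    Bool :=
  decide (i ≠ j ∧ z (.inr s(i, j)) < W.toFun (z (.inl i)) (z (.inl j)))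

section

variable {S T : Type*} [DecidableEq S] [DecidableEq T]

theorem sample_self (z : T ⊕ Sym2 T → unitInterval) (i : T) : W.sample z i i = false := by
  simp [sample]

theorem sample_symm (z : T ⊕ Sym2 T → unitInterval) (i j : T) :
    W.sample z i j = W.sample z j i := by
  rw [sample, sample, decide_eq_decide, Sym2.eq_swap, W.symm', ne_comm]

/-- Consistency of sampling: the graph induced on chosen vertices uses only their own labels and
coins. Injectivity matters because coinciding vertices are never adjacent. -/
theorem sample_comp {v : S → T} (hv : Function.Injective v) (z : T ⊕ Sym2 T → unitInterval)
    (i j : S) : W.sample z (v i) (v j) = W.sample (fun k => z (Sum.map v (Sym2.map v) k)) i j := by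
  rw [sample, sample, decide_eq_decide, hv.ne_iff]
  rfl

theorem measurable_sample (i j : T) :
    Measurable fun z : T ⊕ Sym2 T → unitInterval => W.sample z i j := by
  refine measurable_to_bool ?_
  by_cases h : i = j
  · subst h
    simp [sample_self, Set.preimage]
  · have : (fun z : T ⊕ Sym2 T → unitInterval => W.sample z i j) ⁻¹' {true} =
        {z | z (.inr s(i, j)) < W.toFun (z (.inl i)) (z (.inl j))} := by
      ext z; simp [sample, h]
    rw [this]
    refine measurableSet_lt (by fun_prop) ?_
    exact W.measurable'.comp (by fun_prop : Measurable fun z : T ⊕ Sym2 T → unitInterval =>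
      (z (.inl i), z (.inl j)))

/-- The indicator function of the event that the vertices `x` have the adjacency matrix `a`. -/
noncomputable def pattern {n : ℕ} (a : Fin n → Fin n → Bool) (x : Fin n → T)
    (z : T ⊕ Sym2 T → unitInterval) : ℝ :=
  if (fun i j => W.sample z (x i) (x j)) = a then 1 else 0

theorem measurable_pattern {n : ℕ} (a : Fin n → Fin n → Bool) (x : Fin n → T) :
    Measurable (W.pattern a x) := by
  refine Measurable.ite ?_ measurable_const measurable_const
  have : Measurable fun z i j => W.sample z (x i) (x j) :=
    measurable_pi_lambda _ fun i => measurable_pi_lambda _ fun j => W.measurable_sample _ _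
  exact this (measurableSet_singleton a)

theorem pattern_nonneg {n : ℕ} (a : Fin n → Fin n → Bool) (x : Fin n → T) (z) :
    0 ≤ W.pattern a x z := by
  unfold pattern; split <;> simp

theorem pattern_le_one {n : ℕ} (a : Fin n → Fin n → Bool) (x : Fin n → T) (z) :
    W.pattern a x z ≤ 1 := by
  unfold pattern; split <;> simp

theorem pattern_comp {n : ℕ} (a : Fin n → Fin n → Bool) {v : S → T} (hv : Function.Injective v)
    (x : Fin n → S) (z) :
    W.pattern a (fun i => v (x i)) z = W.pattern a x fun k => z (Sum.map v (Sym2.map v) k) := by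
  simp only [pattern, W.sample_comp hv]

theorem integrable_pattern [Fintype T] {n : ℕ} (a : Fin n → Fin n → Bool) (x : Fin n → T) :
    Integrable (W.pattern a x) :=
  .of_bound (W.measurable_pattern a x).aestronglyMeasurable 1 <| .of_forall fun z => by
    rw [Real.norm_of_nonneg (W.pattern_nonneg a x z)]
    exact W.pattern_le_one a x z

end

theorem integral_lt_eq (w : unitInterval) (b : Bool) :
    ∫ u : unitInterval, (if decide (u < w) = b then (1 : ℝ) else 0) =
      if b then (w : ℝ) else 1 - w := by
  have key (s : Set unitInterval) (hs : MeasurableSet s) [DecidablePred (· ∈ s)] :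
      ∫ u, (if u ∈ s then (1 : ℝ) else 0) = (volume : Measure unitInterval).real s := by
    rw [← integral_indicator_one hs]
    exact integral_congr_ae (.of_forall fun u => by simp [Set.indicator_apply])
  cases b
  · have h := key (Set.Ici w) measurableSet_Ici
    rw [measureReal_def, unitInterval.volume_Ici, ENNReal.toReal_ofReal (sub_nonneg.2 w.2.2)] at h
    simpa using h
  · have h := key (Set.Iio w) measurableSet_Iio
    rw [measureReal_def, unitInterval.volume_Iio, ENNReal.toReal_ofReal w.2.1] at h
    simpa using h

/-- Coins are indexed by unordered pairs while the model multiplies over i < j; this matches the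
two, with the diagonal contributing factors 1. -/
theorem prod_sym2_not_isDiag {n : ℕ} (K : Sym2 (Fin n) → ℝ) :
    ∏ s : Sym2 (Fin n), (if s.IsDiag then 1 else K s) =
      ∏ i : Fin n, ∏ j ∈ Finset.Ioi i, K s(i, j) := by
  -- A statement about sums, read in `Additive ℝ`, becomes one about products.
  have h := Finset.sum_sym2_filter_not_isDiag (M := Additive ℝ) (Finset.univ : Finset (Fin n))
    fun s => Additive.ofMul (K s)
  have h' : ∏ s ∈ Finset.univ.sym2 with ¬ s.IsDiag, K s =
      ∏ p ∈ (Finset.univ : Finset (Fin n)).offDiag with p.1 < p.2, K s(p.1, p.2) := h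
  rw [Finset.prod_sigma']
  rw [Finset.prod_filter] at h'
  refine Eq.trans ?_ (h'.trans ?_)
  · refine Finset.prod_congr (by simp) fun s _ => ?_
    by_cases hs : s.IsDiag <;> simp [hs]
  · refine Finset.prod_nbij' (fun p => ⟨p.1, p.2⟩) (fun p => (p.1, p.2)) ?_ ?_ ?_ ?_ ?_ <;>
      simp +contextual [ne_of_lt]

/-- By Fubini, fix the labels first. The coins are then independent and the indicator of the pattern
is a product over pairs, each factor integrating to W or 1 − W. -/
theorem integral_pattern_id {n : ℕ} (a : Fin n → Fin n → Bool) :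
    ∫ z, W.pattern a (fun i => i) z = W.model n a := by
  unfold model
  by_cases ha : IsAdjMatrix a
  · rw [if_pos ha]
    let w (x : Fin n → unitInterval) : Sym2 (Fin n) → unitInterval :=
      Sym2.lift ⟨fun i j => W.toFun (x i) (x j), fun i j => W.symm' _ _⟩
    let b : Sym2 (Fin n) → Bool := Sym2.lift ⟨fun i j => a i j, fun i j => ha.2 i j⟩
    let e := MeasurableEquiv.sumPiEquivProdPi fun _ : Fin n ⊕ Sym2 (Fin n) => unitInterval
    have he : MeasurePreserving e.symm (volume.prod volume) volume :=
      (volume_measurePreserving_sumPiEquivProdPi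
        fun _ : Fin n ⊕ Sym2 (Fin n) => unitInterval).symm e
    -- Coins also exist for diagonal pairs but are never consulted, hence the disjunct `s.IsDiag`,
    -- which makes their factors 1.
    have hpat (x : Fin n → unitInterval) (u : Sym2 (Fin n) → unitInterval) :
        W.pattern a (fun i => i) (e.symm (x, u)) =
          ∏ s, if s.IsDiag ∨ decide (u s < w x s) = b s then (1 : ℝ) else 0 := by
      rw [Finset.prod_boole]
      unfold pattern
      congr 1
      refine propext ?_
      simp only [Finset.mem_univ, true_imp_iff, Sym2.forall, funext_iff]
      refine forall_congr' fun i => forall_congr' fun j => ?_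
      change decide (i ≠ j ∧ u s(i, j) < W.toFun (x i) (x j)) = a i j ↔
        (s(i, j).IsDiag ∨ decide (u s(i, j) < W.toFun (x i) (x j)) = a i j)
      by_cases hij : i = j
      · subst hij
        simp [ha.1]
      · simp [hij]
    rw [← he.integral_comp']
    refine (integral_prod (fun p => W.pattern a (fun i => i) (e.symm p))
      (he.integrable_comp_of_integrable (W.integrable_pattern a fun i => i))).trans ?_
    refine integral_congr_ae (.of_forall fun x => ?_)
    simp only [hpat]
    rw [integral_fintype_prod_volume_eq_prod fun s u =>
      if s.IsDiag ∨ decide (u < w x s) = b s then (1 : ℝ) else 0]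
    refine Eq.trans (Finset.prod_congr rfl fun s _ => ?_)
      (prod_sym2_not_isDiag fun s => if b s then (w x s : ℝ) else 1 - w x s)
    by_cases hs : s.IsDiag
    · simp [hs]
    · simp only [hs, false_or, if_false]
      exact integral_lt_eq _ _
  · rw [if_neg ha]
    refine integral_eq_zero_of_ae (.of_forall fun z => if_neg fun h => ha ?_)
    subst h
    exact ⟨fun i => W.sample_self z i, fun i j => W.sample_symm z i j⟩

variable {M n : ℕ}

theorem integral_pattern (a : Fin n → Fin n → Bool) {x : Fin n → Fin M}
    (hx : Function.Injective x) : ∫ z, W.pattern a x z = W.model n a := by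
  rw [← W.integral_pattern_id a]
  have h := measurePreserving_comp_of_injective (X := unitInterval)
    (hx.sumMap (Sym2.map.injective hx))
  rw [← h.map_eq, integral_map h.measurable.aemeasurable
    (W.measurable_pattern a _).aestronglyMeasurable]
  exact integral_congr_ae (.of_forall fun z => W.pattern_comp a hx (fun i => i) z)

/-- Disjoint tuples of distinct vertices read disjoint sets of labels and coins, so their patterns
are independent. -/
theorem integral_pattern_mul_pattern (a : Fin n → Fin n → Bool) {x y : Fin n → Fin M}
    (hxy : Function.Injective (Sum.elim x y)) :
    ∫ z, W.pattern a x z * W.pattern a y z = W.model n a ^ 2 := by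
  have hx : Function.Injective x := hxy.comp Sum.inl_injective
  have hy : Function.Injective y := hxy.comp Sum.inr_injective
  have hne (i j) : x i ≠ y j := fun h => Sum.inl_ne_inr (hxy (a₁ := .inl i) (a₂ := .inr j) h)
  -- The coordinates read by the two patterns, as two copies of those of a graph on n vertices.
  -- Coins between a vertex of x and one of y are not among them.
  let E : (Fin n ⊕ Sym2 (Fin n)) ⊕ (Fin n ⊕ Sym2 (Fin n)) → Fin M ⊕ Sym2 (Fin M) :=
    Sum.elim (Sum.map x (Sym2.map x)) (Sum.map y (Sym2.map y))
  have hE : Function.Injective E := by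
    refine (hx.sumMap (Sym2.map.injective hx)).sumElim (hy.sumMap (Sym2.map.injective hy)) ?_
    rintro (i | s) (j | t) h
    · exact hne i j (Sum.inl_injective h)
    · exact Sum.inl_ne_inr h
    · exact Sum.inr_ne_inl h
    · have h' : Sym2.map x s = Sym2.map y t := Sum.inr_injective h
      induction s with | _ i j => ?_
      have : x i ∈ Sym2.map y t := h' ▸ by simp
      obtain ⟨k, -, hk⟩ := Sym2.mem_map.1 this
      exact hne i k hk.symm
  have he := (volume_measurePreserving_sumPiEquivProdPi
    fun _ : (Fin n ⊕ Sym2 (Fin n)) ⊕ (Fin n ⊕ Sym2 (Fin n)) => unitInterval).comp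
    (measurePreserving_comp_of_injective (X := unitInterval) hE)
  have hm := W.measurable_pattern a fun i : Fin n => i
  rw [sq, ← W.integral_pattern_id a, ← integral_prod_mul]
  have hm' : Measurable fun p : (Fin n ⊕ Sym2 (Fin n) → unitInterval) ×
      (Fin n ⊕ Sym2 (Fin n) → unitInterval) =>
      W.pattern a (fun i => i) p.1 * W.pattern a (fun i => i) p.2 :=
    (hm.comp measurable_fst).mul (hm.comp measurable_snd)
  have h := integral_map (μ := volume) he.measurable.aemeasurable
    (f := fun p => W.pattern a (fun i => i) p.1 * W.pattern a (fun i => i) p.2)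
    hm'.aestronglyMeasurable
  rw [he.map_eq] at h
  refine Eq.trans ?_ h.symm
  exact integral_congr_ae (.of_forall fun z => congrArg₂ (· * ·)
    (W.pattern_comp a hx (fun i => i) z) (W.pattern_comp a hy (fun i => i) z))

end Graphon
end GraphonMarkov

/-! ### Concentration of densities and convergent graph sequences -/

namespace GraphonMarkov
open MeasureTheory ProbabilityTheory

namespace Graphon

variable (W : Graphon) {M n : ℕ}

/-- The finite graph sampled from a graphon. -/
noncomputable def sampleGraph (hM : 0 < M) (z : Fin M ⊕ Sym2 (Fin M) → unitInterval) :
    FinGraph where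
  order := M
  order_pos := hM
  adj := W.sample z
  irrefl := W.sample_self z
  symm := W.sample_symm z

theorem density_sampleGraph (hM : 0 < M) (z) (a : Fin n → Fin n → Bool) :
    (W.sampleGraph hM z).density a = ∑ x : Fin n → Fin M, (1 / M : ℝ) ^ n * W.pattern a x z := by
  simp only [FinGraph.density, pattern, mul_ite, mul_one, mul_zero]
  rfl

theorem model_mem_Icc (a : Fin n → Fin n → Bool) : W.model n a ∈ Set.Icc (0 : ℝ) 1 := by
  rw [← W.integral_pattern_id a]
  refine ⟨integral_nonneg fun z => W.pattern_nonneg _ _ _, ?_⟩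
  refine (integral_mono (W.integrable_pattern _ _) (integrable_const 1) fun z =>
    W.pattern_le_one _ _ _).trans ?_
  simp

theorem measurable_density (hM : 0 < M) (a : Fin n → Fin n → Bool) :
    Measurable fun z => (W.sampleGraph hM z).density a := by
  simp only [density_sampleGraph]
  exact Finset.measurable_sum _ fun x _ => (W.measurable_pattern a x).const_mul _

theorem integrable_pattern_mul_pattern (a : Fin n → Fin n → Bool) (x y : Fin n → Fin M) :
    Integrable fun z => W.pattern a x z * W.pattern a y z :=
  .of_bound ((W.measurable_pattern a x).mul (W.measurable_pattern a y)).aestronglyMeasurable 1 <|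
    .of_forall fun z => by
      rw [Real.norm_of_nonneg (mul_nonneg (W.pattern_nonneg a x z) (W.pattern_nonneg a y z))]
      exact mul_le_one₀ (W.pattern_le_one a x z) (W.pattern_nonneg a y z) (W.pattern_le_one a y z)

/-- The covariance of two patterns. -/
theorem integrable_and_integral_pattern_sub_mul (a : Fin n → Fin n → Bool) (x y : Fin n → Fin M) :
    Integrable (fun z => (W.pattern a x z - W.model n a) * (W.pattern a y z - W.model n a)) ∧
      ∫ z, (W.pattern a x z - W.model n a) * (W.pattern a y z - W.model n a) ≤
        if Function.Injective (Sum.elim x y) then 0 else 1 := by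
  set p := W.model n a with hp
  have hx := W.integrable_pattern a x
  have hy := W.integrable_pattern a y
  have hxy := W.integrable_pattern_mul_pattern a x y
  have hexp : (fun z => (W.pattern a x z - p) * (W.pattern a y z - p)) = fun z =>
      W.pattern a x z * W.pattern a y z - p * W.pattern a x z - p * W.pattern a y z + p * p := by
    funext z; ring
  have h₁ : Integrable fun z => W.pattern a x z * W.pattern a y z - p * W.pattern a x z :=
    hxy.sub (hx.const_mul p)
  have h₂ : Integrable fun z => W.pattern a x z * W.pattern a y z - p * W.pattern a x z -
      p * W.pattern a y z := h₁.sub (hy.const_mul p)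
  have hint : Integrable fun z => (W.pattern a x z - p) * (W.pattern a y z - p) := by
    rw [hexp]
    exact h₂.add (integrable_const _)
  refine ⟨hint, ?_⟩
  split_ifs with hinj
  -- Independence and equal means: p² − p·p − p·p + p² = 0.
  · rw [hexp, integral_add h₂ (integrable_const _), integral_sub h₁ (hy.const_mul p),
      integral_sub hxy (hx.const_mul p), integral_const_mul, integral_const_mul,
      W.integral_pattern_mul_pattern a hinj,
      W.integral_pattern a (x := x) (hinj.comp Sum.inl_injective),
      W.integral_pattern a (x := y) (hinj.comp Sum.inr_injective), ← hp]
    simp only [integral_const, probReal_univ, smul_eq_mul]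
    exact le_of_eq (by ring)
  · refine (integral_mono hint (integrable_const 1) fun z => ?_).trans (by simp)
    obtain ⟨h0, h1⟩ := W.model_mem_Icc a
    rw [← hp] at h0 h1
    have hb (w : Fin n → Fin M) : |W.pattern a w z - p| ≤ 1 :=
      abs_le.2 ⟨by linarith [W.pattern_nonneg a w z], by linarith [W.pattern_le_one a w z]⟩
    refine (le_abs_self _).trans ?_
    rw [abs_mul]
    exact mul_le_one₀ (hb x) (abs_nonneg _) (hb y)

/-- The second moment of the deviation of the densities of a random graph. -/
theorem integral_density_sub_sq_le (hM : 0 < M) (a : Fin n → Fin n → Bool) :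
    Integrable (fun z => ((W.sampleGraph hM z).density a - W.model n a) ^ 2) ∧
      ∫ z, ((W.sampleGraph hM z).density a - W.model n a) ^ 2 ≤ ((n + n : ℕ) : ℝ) ^ 2 / M := by
  set p := W.model n a
  set c := (1 / M : ℝ) ^ n
  have hM' : (M : ℝ) ≠ 0 := Nat.cast_ne_zero.2 hM.ne'
  have hc : (M : ℝ) ^ n * c = 1 := by
    rw [← mul_pow, mul_one_div_cancel hM', one_pow]
  -- Since M^n · c = 1, the deviation is an average of centred indicators, and its square is a
  -- double sum of products.
  have hexp : (fun z => ((W.sampleGraph hM z).density a - p) ^ 2) = fun z =>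
      ∑ x : Fin n → Fin M, ∑ y : Fin n → Fin M,
        c ^ 2 * ((W.pattern a x z - p) * (W.pattern a y z - p)) := by
    funext z
    have : (W.sampleGraph hM z).density a - p =
        c * ∑ x : Fin n → Fin M, (W.pattern a x z - p) := by
      rw [density_sampleGraph, Finset.sum_sub_distrib, mul_sub, Finset.mul_sum]
      simp only [Finset.sum_const, Finset.card_univ, Fintype.card_fun, Fintype.card_fin,
        nsmul_eq_mul, Nat.cast_pow]
      rw [← mul_assoc, mul_comm c, hc, one_mul]
    rw [this, mul_pow, sq (∑ x : Fin n → Fin M, (W.pattern a x z - p)), Finset.sum_mul_sum,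
      Finset.mul_sum]
    simp only [Finset.mul_sum]
  have hint (x y : Fin n → Fin M) := (W.integrable_and_integral_pattern_sub_mul a x y).1.const_mul
    (c ^ 2)
  rw [hexp]
  refine ⟨integrable_finsetSum _ fun x _ => integrable_finsetSum _ fun y _ => hint x y, ?_⟩
  rw [integral_finsetSum _ fun x _ => integrable_finsetSum _ fun y _ => hint x y]
  -- Only pairs with a repeated vertex survive. They include tuples x or y that themselves repeat a
  -- vertex, where the mean may differ from p; the bound 1 covers these too.
  calc ∑ x : Fin n → Fin M, ∫ z, ∑ y : Fin n → Fin M,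
        c ^ 2 * ((W.pattern a x z - p) * (W.pattern a y z - p))
      ≤ ∑ x : Fin n → Fin M, ∑ y : Fin n → Fin M,
        c ^ 2 * if Function.Injective (Sum.elim x y) then 0 else 1 := by
        refine Finset.sum_le_sum fun x _ => ?_
        rw [integral_finsetSum _ fun y _ => hint x y]
        refine Finset.sum_le_sum fun y _ => ?_
        rw [integral_const_mul]
        exact mul_le_mul_of_nonneg_left (W.integrable_and_integral_pattern_sub_mul a x y).2
          (sq_nonneg c)
    -- A pair of n-tuples is a single map from a set of 2n points, to which the birthday estimate
    -- applies.
    _ = c ^ 2 * (Finset.univ.filter fun f : Fin n ⊕ Fin n → Fin M =>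
          ¬ Function.Injective f).card := by
        rw [Finset.card_filter, Nat.cast_sum, Finset.mul_sum,
          ← (Equiv.sumArrowEquivProdArrow (Fin n) (Fin n) (Fin M)).symm.sum_comp,
          Fintype.sum_prod_type]
        refine Finset.sum_congr rfl fun x _ => Finset.sum_congr rfl fun y _ => ?_
        change _ = c ^ 2 * ((if ¬ Function.Injective (Sum.elim x y) then 1 else 0 : ℕ) : ℝ)
        split_ifs <;> simp_all
    _ ≤ c ^ 2 * (((n + n : ℕ) : ℝ) ^ 2 / M * (M : ℝ) ^ (n + n)) := by
        refine mul_le_mul_of_nonneg_left ?_ (sq_nonneg c)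
        simpa using card_not_injective_le (Fin n ⊕ Fin n) hM
    _ = ((n + n : ℕ) : ℝ) ^ 2 / M := by
        rw [pow_add, mul_left_comm, ← sq, ← mul_pow, mul_comm c, hc, one_pow, mul_one]

/-- Finite graphs approximate the densities of a graphon. -/
theorem exists_finGraph (m : ℕ) {r : ℝ} (hr : 0 < r) :
    ∃ G : FinGraph, ∀ n ≤ m, ∀ a : Fin n → Fin n → Bool, |G.density a - W.model n a| ≤ r := by
  -- All patterns on at most m vertices: a finite set, so the bounds on the mean square deviations
  -- can be added up to s / M.
  let ι := Σ n : Fin (m + 1), Fin n → Fin n → Bool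
  let s : ℝ := ∑ i : ι, ((i.1 + i.1 : ℕ) : ℝ) ^ 2
  -- Exceeding s / r² makes s / M at most r², and exceeding 0 makes the graph nonempty.
  obtain ⟨M, hM⟩ := exists_nat_gt (max 0 (s / r ^ 2))
  have hM0 : (0 : ℝ) < M := (le_max_left _ _).trans_lt hM
  have hM1 : 0 < M := Nat.cast_pos.1 hM0
  have hs : s / M ≤ r ^ 2 := by
    rw [div_le_iff₀ hM0, mul_comm, ← div_le_iff₀ (pow_pos hr 2)]
    exact ((le_max_right _ _).trans_lt hM).le
  let D (i : ι) (z : Fin M ⊕ Sym2 (Fin M) → unitInterval) : ℝ :=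
    ((W.sampleGraph hM1 z).density i.2 - W.model i.1 i.2) ^ 2
  have hint (i : ι) : Integrable (D i) ∧ ∫ z, D i z ≤ ((i.1 + i.1 : ℕ) : ℝ) ^ 2 / M :=
    W.integral_density_sub_sq_le hM1 i.2
  -- Some outcome is no worse than the mean of the sum of all squared deviations. As the summands
  -- are nonnegative, it controls every pattern simultaneously.
  obtain ⟨z, hz⟩ := exists_le_integral (integrable_finsetSum Finset.univ fun i _ => (hint i).1)
  rw [integral_finsetSum _ fun i _ => (hint i).1] at hz
  have hle : ∑ i, D i z ≤ r ^ 2 := by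
    refine hz.trans (le_trans ?_ hs)
    rw [Finset.sum_div]
    exact Finset.sum_le_sum fun i _ => (hint i).2
  refine ⟨W.sampleGraph hM1 z, fun n hn a => abs_le_of_sq_le_sq (le_trans ?_ hle) hr.le⟩
  have h := Finset.single_le_sum (f := fun i => D i z) (fun i _ => sq_nonneg _)
    (Finset.mem_univ (⟨⟨n, Nat.lt_succ_of_le hn⟩, a⟩ : ι))
  simpa only [D] using h

/-- A sequence of finite graphs converging to a graphon. -/
theorem exists_tendsto_density : ∃ G : ℕ → FinGraph, ∀ (n : ℕ) (a : Fin n → Fin n → Bool),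
    Filter.Tendsto (fun N => (G N).density a) Filter.atTop (nhds (W.model n a)) := by
  -- The N-th graph is within 1/(N + 1) for all patterns on at most N vertices, so a fixed n is
  -- covered as soon as N ≥ n.
  choose G hG using fun N : ℕ => W.exists_finGraph N (Nat.one_div_pos_of_nat (α := ℝ) (n := N))
  refine ⟨G, fun n a => ?_⟩
  rw [tendsto_iff_dist_tendsto_zero]
  refine squeeze_zero' (.of_forall fun _ => dist_nonneg) ?_ tendsto_one_div_add_atTop_nhds_zero_nat
  filter_upwards [Filter.eventually_ge_atTop n] with N hN
  exact hG N n hN a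

end Graphon
end GraphonMarkov

theorem corollary4p3 (W : Graphon) :
    ∃ (C : Type) (_ : Category.{0} C) (_ : MonoidalCategory C) (_ : DistributiveMarkovCategory C)
      (M : Interp C graphInterface) (Ψ : BernoulliBase C),
      IsGraphTheory M ∧
        ∀ (n : ℕ) (a : Fin n → Fin n → Bool),
          Ψ.prob M (isNumeral_matrix n) (graphProgram n) (matrixVal a) = W.model n a := by
  obtain ⟨G, hG⟩ := W.exists_tendsto_density
  exact ⟨AsympStoch, inferInstance, inferInstance, inferInstance, AsympStoch.graphInterp G,
    AsympStoch.bernoulliBase, AsympStoch.isGraphTheory_graphInterp G, fun n a =>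
      -- The ultrafilter is nonprincipal, hence finer than `atTop`, so ordinary limits are limits
      -- along it.
      AsympStoch.prob_graphProgram ((hG n a).mono_left Nat.hyperfilter_le_atTop)⟩
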